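/- Let $b,M>0$. There are constants $C_1,C_2>0$, depending only on $b$ and $M$, with the following property. For each $n$, let the $n$ nodes be partitioned into $r=r_n$ nonempty clusters of sizes $m_1,\dots,m_r$, let $\pi_{\min}=\min_k m_k/n$ and $\pi_{\max}=\max_k m_k/n$, let $Z_0\in\{0,1\}^{n\times r}$ be the membership matrix, and let $X_0=Z_0Z_0^T$ be the (unnormalized) clustering matrix. Let $B=B_n$ be a symmetric $r\times r$ matrix with entries in $[0,1]$ which is strongly assortative for all large $n$, i.e. $\min_k B_{kk}>\max_{k\ne l}B_{kl}$, and suppose that $b\rho\le B_{kl}\le M\rho$ for all $k,l$ and all large $n$, where $\rho=\rho_n>0$ and $\rho_n\to0$. Let $A$ be the adjacency matrix of the stochastic blockmodel: $A$ is symmetric with zero diagonal and its entries $A_{ij}$, $i<j$, are independent Bernoulli variables with $P(A_{ij}=1)=B_{kl}$ if $i$ is in cluster $k$ and $j$ is in cluster $l$. Let $\lambda=\lambda_n$ be real numbers such that, for all large $n$, $$\max_{k\ne l}B_{kl}+C_1\sqrt{\frac{\rho\log n}{n\,\pi_{\min}}}\ \le\ \lambda\ \le\ \min_k B_{kk}-C_2\,\frac{\pi_{\max}}{\pi_{\min}}\sqrt{\frac{\rho\log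 n}{n\,\pi_{\max}^2}} .$$ Then, with probability tending to one as $n\to\infty$, the semidefinite program (SDP-1) $$\max_X\ \operatorname{trace}(AX)-\lambda\operatorname{trace}(XE_n)\quad\text{subject to } X\succeq0,\ X\ge0 \text{ entrywise},\ X_{ii}=1\ (1\le i\le n),$$ where $E_n$ is the $n\times n$ all-ones matrix, exactly recovers $X_0$: the matrix $X_0$ is its unique optimal solution. (A maximum over the empty set is $-\infty$, so for $r=1$ there is no lower bound on $\lambda$. If $\pi_{\max}/\pi_{\min}$ is bounded, the upper bound reads $\min_kB_{kk}-C\sqrt{\rho\log n/(n\pi_{\max}^2)}$ with a constant $C$.) -/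

import Mathlib

open Filter Topology MeasureTheory ProbabilityTheory

noncomputable section

/-- The `n × r` membership matrix `Z` of a labelling of `n` nodes by `r` clusters. -/
def membershipMatrix {n r : ℕ} (z : Fin n → Fin r) : Matrix (Fin n) (Fin r) ℝ :=
  Matrix.of fun i k => if z i = k then 1 else 0

/-- The (unnormalized) clustering matrix `Z Zᵀ`. -/
def clusteringMatrix {n r : ℕ} (z : Fin n → Fin r) : Matrix (Fin n) (Fin n) ℝ :=
  membershipMatrix z * (membershipMatrix z).transpose

/-- The size `m_k` of the cluster `C_k`. -/
def clusterSize {n r : ℕ} (z : Fin n → Fin r) (k : Fin r) : ℕ :=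
  (Finset.univ.filter fun i => z i = k).card

/-- The smallest cluster proportion `π_min = min_k m_k / n`. -/
def piMin {n r : ℕ} (z : Fin n → Fin r) : ℝ := ⨅ k, (clusterSize z k : ℝ) / n

/-- The largest cluster proportion `π_max = max_k m_k / n`. -/
def piMax {n r : ℕ} (z : Fin n → Fin r) : ℝ := ⨆ k, (clusterSize z k : ℝ) / n

/-- A symmetric matrix of probabilities. -/
structure IsBlockProbMatrix {r : ℕ} (B : Matrix (Fin r) (Fin r) ℝ) : Prop where
  symm : B.IsSymm
  mem_Icc : ∀ k l, B k l ∈ Set.Icc (0 : ℝ) 1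

/-- Every diagonal entry exceeds every off-diagonal entry. -/
def StronglyAssortative {r : ℕ} (B : Matrix (Fin r) (Fin r) ℝ) : Prop :=
  ∀ j k l, k ≠ l → B k l < B j j

/-- `A` is the adjacency matrix of a stochastic blockmodel with labelling `z` and block
probabilities `B`: a symmetric `0`-`1` matrix with zero diagonal, whose entries above the
diagonal are independent, the `(i, j)` entry being Bernoulli with parameter `B (z i) (z j)`. -/
structure IsSBM {Ω : Type*} [MeasurableSpace Ω] (μ : Measure Ω) {n r : ℕ}
    (z : Fin n → Fin r) (B : Matrix (Fin r) (Fin r) ℝ)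
    (A : Ω → Matrix (Fin n) (Fin n) ℝ) : Prop where
  measurable : ∀ i j, Measurable fun ω => A ω i j
  binary : ∀ ω i j, A ω i j = 0 ∨ A ω i j = 1
  symm : ∀ ω, (A ω).IsSymm
  diag : ∀ ω i, A ω i i = 0
  prob : ∀ i j, i < j → μ {ω | A ω i j = 1} = ENNReal.ofReal (B (z i) (z j))
  indep : iIndepFun
    (fun (p : {p : Fin n × Fin n // p.1 < p.2}) (ω : Ω) => A ω p.1.1 p.1.2) μ

/-- The feasible set of the semidefinite programme SDP-1:
`X ⪰ 0`, `X ≥ 0` entrywise, and `X_ii = 1`. -/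
def SDP1Feasible {n : ℕ} (X : Matrix (Fin n) (Fin n) ℝ) : Prop :=
  X.PosSemidef ∧ (∀ i j, 0 ≤ X i j) ∧ ∀ i, X i i = 1

/-- The objective `trace (A X) - lam * trace (X E_n)`, `E_n` being the all-ones matrix. -/
def sdp1Objective {n : ℕ} (A : Matrix (Fin n) (Fin n) ℝ) (lam : ℝ)
    (X : Matrix (Fin n) (Fin n) ℝ) : ℝ :=
  (A * X).trace - lam * (X * Matrix.of fun _ _ => (1 : ℝ)).trace

/-- `X` is an optimal solution of SDP-1 with data `A` and multiplier `lam`. -/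
def IsSDP1Solution {n : ℕ} (A : Matrix (Fin n) (Fin n) ℝ) (lam : ℝ)
    (X : Matrix (Fin n) (Fin n) ℝ) : Prop :=
  SDP1Feasible X ∧ ∀ Y, SDP1Feasible Y → sdp1Objective A lam Y ≤ sdp1Objective A lam X

/-- SDP-1 exactly recovers the clustering `z`: the clustering matrix of `z` is its one and
only optimal solution. -/
def SDP1Recovers {n r : ℕ} (A : Matrix (Fin n) (Fin n) ℝ) (lam : ℝ)
    (z : Fin n → Fin r) : Prop :=
  ∀ X, IsSDP1Solution A lam X ↔ X = clusteringMatrix z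

end

noncomputable section
set_option linter.unusedSectionVars false

/-! ### Elementary facts about the programme and its feasible set. -/

section
variable {n r : ℕ} (z : Fin n → Fin r)

/-! The proof combines a dual certificate with two concentration bounds. Let P be the orthogonal
projection onto the span of the cluster indicators, Q = 1 - P and N = diag(d) - A, where d_i is the
within-cluster degree of i minus lam times the size of its cluster. The multiplier for X ⪰ 0 is Λ =
QNQ, and the multiplier for X ≥ 0 is Γ = N + lam E - Λ, which the choice of d makes vanish on the
diagonal blocks. The objective at the clustering matrix exceeds that at a feasible X by ⟨Λ, X⟩ + ⟨Γ,
X⟩. Off the diagonal blocks Γ is positive once the averages of A over a row and a cluster are close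
to B and lam lies above the off-diagonal entries of B. On the range of Q the mean of A reduces to a
diagonal term, so Λ is positive there once the d_i beat the largest eigenvalue of the centred A.
Equality then forces X to be the clustering matrix (`sdp1Recovers_of_certificate`).

With m the smallest cluster size, the row averages fluctuate by at most order √(ρ log n / m), which
is the lower margin for lam. The centred A has largest eigenvalue at most of order √(nρ log n);
divided by m this is the upper margin, in which `piMax` cancels.

For the probabilities, a graph is a Boolean vector with product weights, so every expectation is a
finite sum. Row averages obey a Chernoff bound (`sum_bernWt_deviation_le`). The eigenvalue bound is
a moment argument (`sum_bernWt_spectral_le`): subtract an independent copy, insert random signs,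
apply the noncommutative Khintchine inequality (`sum_trace_signSum_pow_le`), and take a moment of
order about log n. The √(log n) lost in this way is allowed for in the margins. -/

theorem clusteringMatrix_apply (i j : Fin n) :
    clusteringMatrix z i j = if z i = z j then 1 else 0 := by
  simp [clusteringMatrix, membershipMatrix, Matrix.mul_apply, eq_comm]

theorem clusterSize_pos (hz : Function.Surjective z) (k : Fin r) : 0 < clusterSize z k := by
  obtain ⟨i, hi⟩ := hz k
  exact Finset.card_pos.2 ⟨i, by simp [hi]⟩

theorem sdp1Objective_eq (A : Matrix (Fin n) (Fin n) ℝ) (hA : A.IsSymm) (lam : ℝ)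
    (X : Matrix (Fin n) (Fin n) ℝ) :
    sdp1Objective A lam X = ∑ i, ∑ j, (A i j - lam) * X i j := by
  have h : ∀ i j, A i j = A j i := fun i j => hA.apply j i
  have h1 : (A * X).trace = ∑ i, ∑ j, A i j * X i j := by
    simp only [Matrix.trace, Matrix.diag, Matrix.mul_apply]
    rw [Finset.sum_comm]
    exact Finset.sum_congr rfl fun i _ => Finset.sum_congr rfl fun j _ => by rw [h]
  simp only [sdp1Objective, h1, sub_mul, Finset.sum_sub_distrib]
  simp [Matrix.trace, Matrix.mul_apply, Finset.mul_sum]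

theorem SDP1Feasible.le_one {X : Matrix (Fin n) (Fin n) ℝ} (hX : SDP1Feasible X) (i j : Fin n) :
    X i j ≤ 1 := by
  obtain ⟨h1, h2, h3⟩ := hX
  have hs : X j i = X i j := by simpa using h1.1.apply i j
  rcases eq_or_ne i j with rfl | hij
  · exact (h3 i).le
  -- The test vector e_i - e_j gives 2 - 2 X i j ≥ 0.
  have := h1.dotProduct_mulVec_nonneg (Pi.single i 1 - Pi.single j 1)
  simp [Matrix.mulVec_sub, sub_dotProduct, dotProduct_sub, h3, hs] at this
  linarith

theorem clusteringMatrix_feasible : SDP1Feasible (clusteringMatrix z) := by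
  refine ⟨?_, fun i j => ?_, fun i => ?_⟩
  · have := Matrix.posSemidef_self_mul_conjTranspose (membershipMatrix z)
    simpa [clusteringMatrix] using this
  · rw [clusteringMatrix_apply]; split_ifs <;> norm_num
  · simp [clusteringMatrix_apply]

theorem sdp1Recovers_of_lt (A : Matrix (Fin n) (Fin n) ℝ) (lam : ℝ)
    (h : ∀ X, SDP1Feasible X → X ≠ clusteringMatrix z →
      sdp1Objective A lam X < sdp1Objective A lam (clusteringMatrix z)) :
    SDP1Recovers A lam z := by
  intro X
  constructor
  · rintro ⟨hX, hmax⟩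
    by_contra hne
    exact absurd (hmax _ (clusteringMatrix_feasible z)) (not_le.2 (h X hX hne))
  · rintro rfl
    refine ⟨clusteringMatrix_feasible z, fun Y hY => ?_⟩
    by_cases hne : Y = clusteringMatrix z
    · rw [hne]
    · exact (h Y hY hne).le

/-- With a single cluster and a negative multiplier, recovery does not depend on `A`. -/
theorem sdp1Recovers_of_neg (A : Matrix (Fin n) (Fin n) ℝ) (hA : A.IsSymm)
    (hA0 : ∀ i j, 0 ≤ A i j) (lam : ℝ) (hlam : lam < 0) (hz : ∀ i j, z i = z j) :
    SDP1Recovers A lam z := by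
  apply sdp1Recovers_of_lt
  intro X hX hne
  have hone : ∀ i j, clusteringMatrix z i j = 1 := fun i j => by
    simp [clusteringMatrix_apply, hz i j]
  obtain ⟨i, j, hij⟩ : ∃ i j, X i j ≠ 1 := by
    by_contra! hc
    exact hne (by ext i j; rw [hc, hone])
  rw [sdp1Objective_eq A hA, sdp1Objective_eq A hA]
  have hle : ∀ i j, (A i j - lam) * X i j ≤ (A i j - lam) * clusteringMatrix z i j := by
    intro i j
    rw [hone]
    exact mul_le_mul_of_nonneg_left (hX.le_one i j) (by linarith [hA0 i j])
  refine Finset.sum_lt_sum (fun i _ => Finset.sum_le_sum fun j _ => hle i j)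
    ⟨i, Finset.mem_univ _, Finset.sum_lt_sum (fun j _ => hle i j) ⟨j, Finset.mem_univ _, ?_⟩⟩
  rw [hone]
  exact mul_lt_mul_of_pos_left (lt_of_le_of_ne (hX.le_one i j) hij) (by linarith [hA0 i j])

end

/-! ### The dual certificate. -/

section
variable {n r : ℕ} (z : Fin n → Fin r)

/-- The orthogonal projection onto the span of the cluster indicators. -/
def clusterProj : Matrix (Fin n) (Fin n) ℝ :=
  Matrix.of fun i j => if z i = z j then (clusterSize z (z i) : ℝ)⁻¹ else 0

theorem clusterProj_symm : (clusterProj z).IsSymm := by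
  ext i j
  by_cases h : z i = z j <;> simp [clusterProj, h, eq_comm]

theorem clusterProj_mul_apply (N : Matrix (Fin n) (Fin n) ℝ) (i j : Fin n) :
    (clusterProj z * N) i j = (∑ i' with z i' = z i, N i' j) / clusterSize z (z i) := by
  simp [clusterProj, Matrix.mul_apply, Finset.sum_filter, eq_comm, div_eq_inv_mul, Finset.mul_sum]

theorem mul_clusterProj_apply (N : Matrix (Fin n) (Fin n) ℝ) (i j : Fin n) :
    (N * clusterProj z) i j = (∑ j' with z j' = z j, N i j') / clusterSize z (z j) := by
  rw [← Matrix.transpose_apply (N * _), Matrix.transpose_mul, (clusterProj_symm z).eq,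
    clusterProj_mul_apply]
  rfl

theorem clusterSize_ne_zero (i : Fin n) : (clusterSize z (z i) : ℝ) ≠ 0 := by
  have : 0 < clusterSize z (z i) := Finset.card_pos.2 ⟨i, by simp⟩
  positivity

theorem sum_const_cluster (k : Fin r) (c : ℝ) :
    ∑ i with z i = k, c = clusterSize z k * c := by
  simp [clusterSize]

theorem clusterProj_mul_self : clusterProj z * clusterProj z = clusterProj z := by
  ext i j
  rw [clusterProj_mul_apply, Finset.sum_congr rfl (g := fun _ => clusterProj z i j)]
  · rw [sum_const_cluster, mul_div_cancel_left₀ _ (clusterSize_ne_zero z i)]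
  · intro i' hi'
    simp only [Finset.mem_filter, Finset.mem_univ, true_and] at hi'
    simp [clusterProj, hi']

-- Writing Y = CᵀC makes the pairing a sum of quadratic forms of W at the rows of C, so a bound on
-- the form suffices and no spectral theory of W is needed.
open scoped MatrixOrder in
theorem sum_mul_posSemidef_le {W Y : Matrix (Fin n) (Fin n) ℝ} {t : ℝ}
    (hW : ∀ x : Fin n → ℝ, ∑ i, ∑ j, W i j * (x i * x j) ≤ t * ∑ i, x i ^ 2)
    (hY : Y.PosSemidef) : ∑ i, ∑ j, W i j * Y i j ≤ t * ∑ i, Y i i := by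
  obtain ⟨C, rfl⟩ := CStarAlgebra.nonneg_iff_eq_star_mul_self.1 hY.nonneg
  calc ∑ i, ∑ j, W i j * (star C * C) i j
      = ∑ k, ∑ i, ∑ j, W i j * (C k i * C k j) := by
        simp only [Matrix.mul_apply, Matrix.star_apply, star_trivial, Finset.mul_sum]
        rw [Finset.sum_comm (s := Finset.univ) (t := Finset.univ)
          (f := fun k i => ∑ j, W i j * (C k i * C k j))]
        exact Finset.sum_congr rfl fun i _ => Finset.sum_comm
    _ ≤ ∑ k, t * ∑ i, C k i ^ 2 := Finset.sum_le_sum fun k _ => hW _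
    _ = _ := by
        rw [← Finset.mul_sum, Finset.sum_comm]
        simp [Matrix.mul_apply, sq]

/-- A block-constant matrix only sees the sums of each column of Y over clusters, and these vanish
when P Y = 0. This removes the mean of A from the certificate. -/
theorem sum_block_mul_eq_zero {Y : Matrix (Fin n) (Fin n) ℝ} (hY : clusterProj z * Y = 0)
    (B : Matrix (Fin r) (Fin r) ℝ) : ∑ i, ∑ j, B (z i) (z j) * Y i j = 0 := by
  rw [Finset.sum_comm]
  refine Finset.sum_eq_zero fun j _ => ?_
  rw [← Finset.sum_fiberwise Finset.univ z]
  refine Finset.sum_eq_zero fun k _ => ?_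
  by_cases hk : ∃ i, z i = k
  · obtain ⟨i, rfl⟩ := hk
    have h := congrFun (congrFun hY i) j
    rw [clusterProj_mul_apply, Matrix.zero_apply, div_eq_zero_iff] at h
    have h := h.resolve_right (clusterSize_ne_zero z i)
    rw [Finset.sum_congr rfl (g := fun i' => B (z i) (z j) * Y i' j), ← Finset.mul_sum, h, mul_zero]
    intro i' hi'
    simp only [Finset.mem_filter, Finset.mem_univ, true_and] at hi'
    rw [hi']
  · push Not at hk
    exact Finset.sum_eq_zero fun i hi => absurd (by simpa using hi) (hk i)

/-- A dual certificate: if the centred adjacency matrix is spectrally small, the within-cluster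
degrees are large and the between-cluster averages are close to their means, then the programme
recovers the clustering. -/
theorem sdp1Recovers_of_certificate (A : Matrix (Fin n) (Fin n) ℝ)
    (hA : A.IsSymm) (B : Matrix (Fin r) (Fin r) ℝ) (hB : B.IsSymm) (lam t δ : ℝ)
    (hspec : ∀ x : Fin n → ℝ, ∑ i, ∑ j, (A i j - if i = j then 0 else B (z i) (z j)) * (x i * x j)
      ≤ t * ∑ i, x i ^ 2)
    (hdeg : ∀ i, t < (∑ j with z j = z i, A i j) - clusterSize z (z i) * lam + B (z i) (z i))
    (hoff : ∀ i j, z i ≠ z j →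
      |(∑ j' with z j' = z j, A i j') / clusterSize z (z j) - B (z i) (z j)| ≤ δ)
    (hlam : ∀ k l, k ≠ l → B k l + 3 * δ < lam) :
    SDP1Recovers A lam z := by
  set s : Fin r → ℝ := fun k => (clusterSize z k : ℝ) with hs
  -- With this d, N maps the indicator of a cluster to -lam times the cluster size at each of its
  -- own nodes, so N P equals -lam on diagonal blocks.
  set d : Fin n → ℝ := fun i => (∑ j with z j = z i, A i j) - s (z i) * lam with hd
  set P := clusterProj z with hP
  set Q := 1 - P with hQ
  set N := Matrix.diagonal d - A with hN
  have hPP : P * P = P := clusterProj_mul_self z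
  have hPt : P.transpose = P := clusterProj_symm z
  have hQQ : Q * Q = Q := by rw [hQ, sub_mul, mul_sub, mul_sub, hPP]; simp
  have hPQ : P * Q = 0 := by rw [hQ, mul_sub, hPP, mul_one, sub_self]
  have hQt : Q.transpose = Q := by simp [hQ, hPt]
  have hNt : N.transpose = N := by simp [hN, hA.eq]
  have hNP : ∀ i j, (N * P) i j = if z i = z j then -lam else
      -((∑ j' with z j' = z j, A i j') / s (z j)) := by
    intro i j
    rw [hP, mul_clusterProj_apply]
    simp only [hN, Matrix.sub_apply, Finset.sum_sub_distrib, Matrix.diagonal_apply]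
    split_ifs with h
    · rw [Finset.sum_ite_eq, if_pos (by simpa using h), div_eq_iff (clusterSize_ne_zero z j)]
      simp only [hd, h, hs]; ring
    · rw [Finset.sum_ite_eq, if_neg (by simpa using h)]
      simp only [hs]; ring
  have hPN : ∀ i j, (P * N) i j = (N * P) j i := by
    intro i j
    rw [← Matrix.transpose_apply (N * P), Matrix.transpose_mul, hPt, hNt]
  have hPNP : ∀ i j, z i = z j → (P * (N * P)) i j = -lam := by
    intro i j h
    rw [hP, clusterProj_mul_apply, ← hP, Finset.sum_congr rfl (g := fun _ => -lam),
      sum_const_cluster, mul_div_cancel_left₀ _ (clusterSize_ne_zero z i)]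
    intro i' hi'
    simp only [Finset.mem_filter, Finset.mem_univ, true_and] at hi'
    rw [hNP, if_pos (hi'.trans h)]
  have hPNP' : ∀ i j, z i ≠ z j → (P * (N * P)) i j ≤ -(B (z i) (z j) - δ) := by
    intro i j h
    rw [hP, clusterProj_mul_apply, ← hP, div_le_iff₀
      (lt_of_le_of_ne (Nat.cast_nonneg _) (clusterSize_ne_zero z i).symm), mul_comm,
      ← sum_const_cluster]
    refine Finset.sum_le_sum fun i' hi' => ?_
    simp only [Finset.mem_filter, Finset.mem_univ, true_and] at hi'
    have := (abs_le.1 (hoff i' j (by rwa [hi']))).1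
    rw [hNP, if_neg (by rwa [hi'])]
    rw [hi'] at this
    simp only [hs]
    linarith
  set Λ := Q * N * Q with hΛ
  have hΛe : ∀ i j, Λ i j = N i j - (P * N) i j - (N * P) i j + (P * (N * P)) i j := by
    intro i j
    have : Λ = N - P * N - N * P + P * (N * P) := by rw [hΛ, hQ]; noncomm_ring
    rw [this]; rfl
  have hdiagblock : ∀ i j, z i = z j → Λ i j = N i j + lam := by
    intro i j h
    rw [hΛe, hPN, hPNP i j h, hNP, hNP, if_pos h, if_pos h.symm]; ring
  -- The two one-sided averages are each at most B + δ and the two-sided one is at least B - δ.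
  -- Together they contribute at most B + 3δ, which explains the 3δ in `hlam`.
  have hoffblock : ∀ i j, z i ≠ z j → Λ i j < N i j + lam := by
    intro i j h
    rw [hΛe, hPN, hNP, hNP, if_neg h, if_neg h.symm]
    have h1 := hPNP' i j h
    have h2 := (abs_le.1 (hoff i j h)).2
    have h3 := (abs_le.1 (hoff j i h.symm)).2
    have h4 := hlam _ _ h
    have h5 : B (z j) (z i) = B (z i) (z j) := hB.apply _ _
    simp only [hs]
    linarith
  apply sdp1Recovers_of_lt
  intro X hX hne
  obtain ⟨hX1, hX2, hX3⟩ := id hX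
  have hXs : ∀ i j, X j i = X i j := fun i j => by simpa using hX1.1.apply i j
  set Y := Q * X * Q with hY
  have hYpsd : Y.PosSemidef := by
    have := hX1.mul_mul_conjTranspose_same Q
    rwa [Matrix.conjTranspose_eq_transpose_of_trivial, hQt] at this
  have hPY : P * Y = 0 := by rw [hY, ← mul_assoc, ← mul_assoc, hPQ, zero_mul, zero_mul]
  -- the contribution of the positive semidefinite multiplier
  have hΛX : ∑ i, ∑ j, Λ i j * X i j = ∑ i, ∑ j, N i j * Y i j := by
    have e : ∀ S T : Matrix (Fin n) (Fin n) ℝ, T.transpose = T →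
        ∑ i, ∑ j, S i j * T i j = (S * T).trace := by
      intro S T hT
      simp only [Matrix.trace, Matrix.diag, Matrix.mul_apply]
      refine Finset.sum_congr rfl fun i _ => Finset.sum_congr rfl fun j _ => ?_
      rw [← Matrix.transpose_apply T, hT]
    have hXt : X.transpose = X := by ext i j; exact hXs i j
    rw [e Λ X hXt, e N Y (by rw [hY, Matrix.transpose_mul, Matrix.transpose_mul, hQt, hXt,
      mul_assoc]), hΛ, hY, mul_assoc, mul_assoc, Matrix.trace_mul_comm]
    simp only [mul_assoc]
  -- The block-constant mean pairs to zero with Y. The mean of A has zero diagonal, however, and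
  -- this correction leaves the extra terms B (z i) (z i).
  have hNY : ∑ i, (d i + B (z i) (z i) - t) * Y i i ≤ ∑ i, ∑ j, N i j * Y i j := by
    have h1 := sum_mul_posSemidef_le hspec hYpsd
    have h2 := sum_block_mul_eq_zero z hPY B
    have h3 : ∑ i, ∑ j, N i j * Y i j = ∑ i, (d i + B (z i) (z i)) * Y i i
        - (∑ i, ∑ j, (A i j - if i = j then 0 else B (z i) (z j)) * Y i j)
        - ∑ i, ∑ j, B (z i) (z j) * Y i j := by
      rw [← Finset.sum_sub_distrib, ← Finset.sum_sub_distrib]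
      refine Finset.sum_congr rfl fun i _ => ?_
      have : (d i + B (z i) (z i)) * Y i i
          = ∑ j, (if i = j then (d i + B (z i) (z i)) * Y i j else 0) := by simp
      rw [this, ← Finset.sum_sub_distrib, ← Finset.sum_sub_distrib]
      refine Finset.sum_congr rfl fun j _ => ?_
      simp only [hN, Matrix.sub_apply, Matrix.diagonal_apply]
      split_ifs with h
      · subst h; ring
      · ring
    rw [h3, h2]
    simp only [sub_mul (d _ + _), Finset.sum_sub_distrib, ← Finset.mul_sum]
    linarith
  -- the gap between the two objective values
  have hcl := clusteringMatrix_apply z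
  have hgap : sdp1Objective A lam (clusteringMatrix z) - sdp1Objective A lam X
      = ∑ i, ∑ j, Λ i j * X i j + ∑ i, ∑ j, (N i j + lam - Λ i j) * X i j := by
    have h1 : sdp1Objective A lam (clusteringMatrix z) = ∑ i, d i := by
      rw [sdp1Objective_eq A hA]
      refine Finset.sum_congr rfl fun i _ => ?_
      simp only [hcl, mul_ite, mul_one, mul_zero, hd]
      rw [← Finset.sum_filter, Finset.sum_sub_distrib]
      simp_rw [eq_comm (a := z i)]
      rw [sum_const_cluster]
    have h2 : ∑ i, d i = ∑ i, ∑ j, Matrix.diagonal d i j * X i j := by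
      refine Finset.sum_congr rfl fun i _ => ?_
      simp [Matrix.diagonal_apply, hX3]
    rw [h1, h2, sdp1Objective_eq A hA]
    simp only [← Finset.sum_sub_distrib, ← Finset.sum_add_distrib]
    refine Finset.sum_congr rfl fun i _ => Finset.sum_congr rfl fun j _ => ?_
    simp only [hN, Matrix.sub_apply]; ring
  have hYnn : ∀ i, 0 ≤ (d i + B (z i) (z i) - t) * Y i i := fun i =>
    mul_nonneg (by have := hdeg i; simp only [hd]; linarith) hYpsd.diag_nonneg
  have hΓnn : ∀ i j, 0 ≤ (N i j + lam - Λ i j) * X i j := by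
    intro i j
    refine mul_nonneg ?_ (hX2 i j)
    by_cases h : z i = z j
    · rw [hdiagblock i j h, sub_self]
    · linarith [hoffblock i j h]
  by_contra hlt
  rw [not_lt] at hlt
  have hY0 := Finset.sum_nonneg fun i (_ : i ∈ Finset.univ) => hYnn i
  have hΓ0 := Finset.sum_nonneg fun i (_ : i ∈ Finset.univ) =>
    Finset.sum_nonneg fun j (_ : j ∈ Finset.univ) => hΓnn i j
  have hYz : ∀ i, Y i i = 0 := by
    intro i
    have := (Finset.sum_eq_zero_iff_of_nonneg fun i (_ : i ∈ Finset.univ) => hYnn i).1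
      (by linarith) i (Finset.mem_univ i)
    refine (mul_eq_zero.1 this).resolve_left (ne_of_gt ?_)
    have := hdeg i; simp only [hd]; linarith
  have hΓz : ∀ i j, z i ≠ z j → X i j = 0 := by
    intro i j h
    have h1 := (Finset.sum_eq_zero_iff_of_nonneg fun i (_ : i ∈ Finset.univ) =>
      Finset.sum_nonneg fun j (_ : j ∈ Finset.univ) => hΓnn i j).1
      (by linarith) i (Finset.mem_univ i)
    have h2 := (Finset.sum_eq_zero_iff_of_nonneg fun j (_ : j ∈ Finset.univ) => hΓnn i j).1
      h1 j (Finset.mem_univ j)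
    refine (mul_eq_zero.1 h2).resolve_left (ne_of_gt ?_)
    linarith [hoffblock i j h]
  -- Zero diagonal of Y gives trace (Q X) = 0, so trace (P X) = trace X = trace P 𝟙 with 𝟙 the
  -- all-ones matrix. As X ≤ 1 entrywise, X must equal 1 wherever P is positive.
  have htr : ∑ i, ∑ j, P i j * (1 - X i j) = 0 := by
    have h1 : (Q * X).trace = 0 := by
      have : Y.trace = 0 := Finset.sum_eq_zero fun i _ => hYz i
      rwa [hY, Matrix.trace_mul_comm, ← mul_assoc, hQQ] at this
    rw [hQ, sub_mul, one_mul, Matrix.trace_sub, sub_eq_zero] at h1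
    simp only [Matrix.trace, Matrix.diag, hX3, Matrix.mul_apply, hXs] at h1
    simp only [mul_sub, mul_one, Finset.sum_sub_distrib, ← h1]
    rw [sub_eq_zero]
    refine Finset.sum_congr rfl fun i _ => ?_
    have := clusterProj_mul_apply z (Matrix.of fun _ _ => 1) i i
    rw [Matrix.mul_apply] at this
    simp only [Matrix.of_apply, mul_one] at this
    rw [hP, this, sum_const_cluster, mul_one, div_self (clusterSize_ne_zero z i)]
  have hPnn : ∀ i j, 0 ≤ P i j * (1 - X i j) := fun i j => mul_nonneg
    (by simp only [hP, clusterProj, Matrix.of_apply]; split_ifs <;> positivity)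
    (by linarith [hX.le_one i j])
  refine hne ?_
  ext i j
  rw [hcl]
  split_ifs with h
  · have h1 := (Finset.sum_eq_zero_iff_of_nonneg fun i (_ : i ∈ Finset.univ) =>
      Finset.sum_nonneg fun j (_ : j ∈ Finset.univ) => hPnn i j).1 htr i (Finset.mem_univ i)
    have h2 := (Finset.sum_eq_zero_iff_of_nonneg fun j (_ : j ∈ Finset.univ) => hPnn i j).1
      h1 j (Finset.mem_univ j)
    have h3 := (mul_eq_zero.1 h2).resolve_left (by
      simp only [hP, clusterProj, Matrix.of_apply, if_pos h]
      exact inv_ne_zero (clusterSize_ne_zero z i))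
    linarith
  · exact hΓz i j h

end

/-! ### The noncommutative Khintchine inequality for traces of even powers. -/

section Khintchine
variable {N E : Type*} [Fintype N] [DecidableEq N] [Fintype E] [DecidableEq E]

/-- For nonnegative numbers this is (a^m - b^m)(a^l - b^l) ≥ 0; the even total degree reduces the
general case to absolute values. -/
theorem pow_mul_pow_add_le (x y : ℝ) {p q : ℕ} (hq : q ≤ 2 * p) :
    x ^ q * y ^ (2 * p - q) + x ^ (2 * p - q) * y ^ q ≤ x ^ (2 * p) + y ^ (2 * p) := by
  have key : ∀ a b : ℝ, 0 ≤ a → 0 ≤ b → ∀ m l : ℕ,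
      a ^ m * b ^ l + a ^ l * b ^ m ≤ a ^ (m + l) + b ^ (m + l) := by
    intro a b ha hb m l
    have : 0 ≤ (a ^ m - b ^ m) * (a ^ l - b ^ l) := by
      rcases le_total a b with h | h
      · exact mul_nonneg_of_nonpos_of_nonpos
          (sub_nonpos.2 (pow_le_pow_left₀ ha h _)) (sub_nonpos.2 (pow_le_pow_left₀ ha h _))
      · exact mul_nonneg
          (sub_nonneg.2 (pow_le_pow_left₀ hb h _)) (sub_nonneg.2 (pow_le_pow_left₀ hb h _))
    rw [pow_add, pow_add]
    linarith
  have h := key |x| |y| (abs_nonneg _) (abs_nonneg _) q (2 * p - q)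
  rw [Nat.add_sub_cancel' hq, (even_two_mul p).pow_abs, (even_two_mul p).pow_abs] at h
  refine le_trans (add_le_add ?_ ?_) h
  · rw [← abs_pow, ← abs_pow, ← abs_mul]; exact le_abs_self _
  · rw [← abs_pow, ← abs_pow, ← abs_mul]; exact le_abs_self _

theorem sum_pow_mul_pow_le (x y : ℝ) (p : ℕ) :
    ∑ q ∈ Finset.range (2 * p + 1), x ^ q * y ^ (2 * p - q)
      ≤ (2 * p + 1) / 2 * (x ^ (2 * p) + y ^ (2 * p)) := by
  have h1 := Finset.sum_range_reflect (fun q => x ^ q * y ^ (2 * p - q)) (2 * p + 1)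
  have h2 : ∑ q ∈ Finset.range (2 * p + 1), x ^ (2 * p + 1 - 1 - q) *
      y ^ (2 * p - (2 * p + 1 - 1 - q)) =
      ∑ q ∈ Finset.range (2 * p + 1), x ^ (2 * p - q) * y ^ q := by
    refine Finset.sum_congr rfl fun q hq => ?_
    have := Finset.mem_range.1 hq
    congr 2; omega
  have h3 : ∑ q ∈ Finset.range (2 * p + 1),
      (x ^ q * y ^ (2 * p - q) + x ^ (2 * p - q) * y ^ q)
      ≤ ∑ q ∈ Finset.range (2 * p + 1), (x ^ (2 * p) + y ^ (2 * p)) :=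
    Finset.sum_le_sum fun q hq =>
      pow_mul_pow_add_le x y (by have := Finset.mem_range.1 hq; omega)
  rw [Finset.sum_add_distrib, ← h2, h1] at h3
  simp only [Finset.sum_const, Finset.card_range, nsmul_eq_mul] at h3
  push_cast at h3
  linarith

theorem noncomm_pow_sub_pow_eq_sum {R : Type*} [Ring R] (X Y : R) (m : ℕ) :
    X ^ m - Y ^ m = ∑ q ∈ Finset.range m, X ^ q * (X - Y) * Y ^ (m - 1 - q) := by
  induction m with
  | zero => simp
  | succ m ih =>
    rw [Finset.sum_range_succ]
    have : ∑ q ∈ Finset.range m, X ^ q * (X - Y) * Y ^ (m + 1 - 1 - q)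
        = (∑ q ∈ Finset.range m, X ^ q * (X - Y) * Y ^ (m - 1 - q)) * Y := by
      rw [Finset.sum_mul]
      refine Finset.sum_congr rfl fun q hq => ?_
      have := Finset.mem_range.1 hq
      rw [mul_assoc _ _ Y, ← pow_succ]
      congr 2; omega
    rw [this, ← ih]
    simp only [add_tsub_cancel_right, tsub_self, pow_zero, mul_one, pow_succ]
    noncomm_ring

/-- Orthogonal diagonalization of a real symmetric matrix, with all its powers. -/
theorem Matrix.IsSymm.exists_diagonalization {X : Matrix N N ℝ} (hX : X.IsSymm) :
    ∃ (U : Matrix N N ℝ) (x : N → ℝ), U * U.transpose = 1 ∧ U.transpose * U = 1 ∧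
      ∀ q : ℕ, X ^ q = U * Matrix.diagonal (fun i => x i ^ q) * U.transpose := by
  have hH : X.IsHermitian := by
    rw [Matrix.IsHermitian, Matrix.conjTranspose_eq_transpose_of_trivial]; exact hX
  set U : Matrix N N ℝ := hH.eigenvectorUnitary.1 with hU
  have hs : star U = U.transpose := by
    rw [Matrix.star_eq_conjTranspose, Matrix.conjTranspose_eq_transpose_of_trivial]
  have h1 : U * U.transpose = 1 := by
    rw [← hs]; exact Unitary.mul_star_self_of_mem hH.eigenvectorUnitary.2
  have h2 : U.transpose * U = 1 := by
    rw [← hs]; exact Unitary.star_mul_self_of_mem hH.eigenvectorUnitary.2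
  obtain ⟨x, hsp⟩ : ∃ x, X = U * Matrix.diagonal x * U.transpose := by
    refine ⟨hH.eigenvalues, ?_⟩
    conv_lhs => rw [hH.spectral_theorem, Unitary.conjStarAlgAut_apply]
    rw [← hs]; rfl
  refine ⟨U, x, h1, h2, fun q => ?_⟩
  induction q with
  | zero => simp [h1]
  | succ q ih =>
    rw [pow_succ, ih]
    conv_lhs => rw [hsp]
    calc _ = U * Matrix.diagonal (fun i => x i ^ q) * (U.transpose * U) *
          Matrix.diagonal x * U.transpose := by simp only [mul_assoc]
      _ = _ := by
        rw [h2, mul_one, mul_assoc U, Matrix.diagonal_mul_diagonal]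
        simp only [pow_succ]

/-- In the two eigenbases the mixed trace has the nonnegative weights G i j ^ 2, so scalar
inequalities between eigenvalues pass to traces even though the matrices do not commute. -/
theorem trace_mul_diagonal_conj (U V H : Matrix N N ℝ) (hH : H.IsSymm) (x y : N → ℝ) :
    (H * (U * Matrix.diagonal x * U.transpose) * H *
      (V * Matrix.diagonal y * V.transpose)).trace
      = ∑ i, ∑ j, x i * y j * (U.transpose * H * V) i j ^ 2 := by
  set G := U.transpose * H * V with hG
  have hGt : G.transpose = V.transpose * H * U := by
    simp [hG, Matrix.transpose_mul, hH.eq, mul_assoc]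
  have : (H * (U * Matrix.diagonal x * U.transpose) * H *
      (V * Matrix.diagonal y * V.transpose)).trace
      = (Matrix.diagonal x * G * (Matrix.diagonal y * G.transpose)).trace := by
    rw [hGt, hG]
    calc _ = ((H * U) * (Matrix.diagonal x * U.transpose * H *
          V * Matrix.diagonal y * V.transpose)).trace := by simp only [mul_assoc]
      _ = _ := by rw [Matrix.trace_mul_comm]; simp only [mul_assoc]
  rw [this]
  simp only [Matrix.trace, Matrix.diag, Matrix.mul_apply (M := Matrix.diagonal x * G),
    Matrix.diagonal_mul, Matrix.transpose_apply]
  exact Finset.sum_congr rfl fun i _ => Finset.sum_congr rfl fun j _ => by ring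

/-- The arithmetic-geometric mean inequality for traces. -/
theorem sum_trace_pow_mul_pow_le {H X Y : Matrix N N ℝ} (hH : H.IsSymm) (hX : X.IsSymm)
    (hY : Y.IsSymm) (p : ℕ) :
    ∑ q ∈ Finset.range (2 * p + 1), (H * X ^ q * H * Y ^ (2 * p - q)).trace
      ≤ (2 * p + 1) / 2 *
        ((H * H * X ^ (2 * p)).trace + (H * H * Y ^ (2 * p)).trace) := by
  obtain ⟨U, x, -, -, hx⟩ := hX.exists_diagonalization
  obtain ⟨V, y, -, -, hy⟩ := hY.exists_diagonalization
  have h : ∀ q r, (H * X ^ q * H * Y ^ r).trace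
      = ∑ i, ∑ j, x i ^ q * y j ^ r * (U.transpose * H * V) i j ^ 2 := fun q r => by
    rw [hx, hy, trace_mul_diagonal_conj _ _ _ hH]
  have h1 : (H * H * X ^ (2 * p)).trace = (H * X ^ (2 * p) * H * Y ^ 0).trace := by
    rw [pow_zero, mul_one, mul_assoc, Matrix.trace_mul_comm]
  have h2 : (H * H * Y ^ (2 * p)).trace = (H * X ^ 0 * H * Y ^ (2 * p)).trace := by
    rw [pow_zero, mul_one]
  rw [h1, h2]
  simp only [h]
  rw [Finset.sum_comm, ← Finset.sum_add_distrib, Finset.mul_sum]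
  refine Finset.sum_le_sum fun i _ => ?_
  rw [Finset.sum_comm, ← Finset.sum_add_distrib, Finset.mul_sum]
  refine Finset.sum_le_sum fun j _ => ?_
  rw [← Finset.sum_mul]
  have := mul_le_mul_of_nonneg_right (sum_pow_mul_pow_le (x i) (y j) p)
    (sq_nonneg ((U.transpose * H * V) i j))
  linarith

/-- The sign attached to a Boolean. -/
def boolSign (b : Bool) : ℝ := if b then 1 else -1

theorem boolSign_mul_self (b : Bool) : boolSign b * boolSign b = 1 := by
  cases b <;> simp [boolSign]

theorem boolSign_not (b : Bool) : boolSign (!b) = -boolSign b := by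
  cases b <;> simp [boolSign]

/-- Flipping one coordinate of a Boolean vector. -/
def flipAt (e : E) (s : E → Bool) : E → Bool := Function.update s e (!s e)

theorem flipAt_involutive (e : E) : Function.Involutive (flipAt e) := by
  intro s
  ext f
  by_cases h : f = e
  · subst h; simp [flipAt]
  · simp [flipAt, h]

theorem sum_flipAt {M : Type*} [AddCommMonoid M] (e : E) (g : (E → Bool) → M) :
    ∑ s, g (flipAt e s) = ∑ s, g s :=
  Equiv.sum_comp (flipAt_involutive e).toPerm g

/-- A Rademacher sum of matrices. -/
def signSum (H : E → Matrix N N ℝ) (s : E → Bool) : Matrix N N ℝ :=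
  ∑ e, boolSign (s e) • H e

theorem signSum_isSymm {H : E → Matrix N N ℝ} (hH : ∀ e, (H e).IsSymm) (s : E → Bool) :
    (signSum H s).IsSymm := by
  simp only [signSum, Matrix.IsSymm, Matrix.transpose_sum, Matrix.transpose_smul, (hH _).eq]

theorem signSum_sub_flipAt (H : E → Matrix N N ℝ) (s : E → Bool) (e : E) :
    signSum H s - signSum H (flipAt e s) = (2 * boolSign (s e)) • H e := by
  simp only [signSum, ← Finset.sum_sub_distrib, ← sub_smul]
  rw [Finset.sum_eq_single e]
  · simp only [flipAt, Function.update_self, boolSign_not]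
    congr 1; ring
  · intro f _ hf
    simp [flipAt, hf]
  · simp

/-- Flipping the sign at e preserves the uniform measure, so the left side is half the sum of the
differences between the trace terms at s and at its flip. The difference of powers telescopes around
2 s_e H_e, the two signs cancel, and the trace form of the arithmetic-geometric mean inequality
applies. -/
theorem sum_sign_trace_le {H : E → Matrix N N ℝ} (hH : ∀ e, (H e).IsSymm) (p : ℕ) (e : E) :
    ∑ s, boolSign (s e) * (H e * signSum H s ^ (2 * p + 1)).trace
      ≤ (2 * p + 1) * ∑ s, (H e * H e * signSum H s ^ (2 * p)).trace := by
  have h1 : ∑ s, boolSign (s e) * (H e * signSum H s ^ (2 * p + 1)).trace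
      = -∑ s, boolSign (s e) * (H e * signSum H (flipAt e s) ^ (2 * p + 1)).trace := by
    rw [← sum_flipAt e, ← Finset.sum_neg_distrib]
    refine Finset.sum_congr rfl fun s _ => ?_
    simp only [flipAt, Function.update_self, boolSign_not, neg_mul]
  have h2 : ∀ s, boolSign (s e) * (H e * signSum H s ^ (2 * p + 1)).trace
      - boolSign (s e) * (H e * signSum H (flipAt e s) ^ (2 * p + 1)).trace
      = 2 * ∑ q ∈ Finset.range (2 * p + 1),
        (H e * signSum H s ^ q * H e * signSum H (flipAt e s) ^ (2 * p - q)).trace := by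
    intro s
    rw [← mul_sub, ← Matrix.trace_sub, ← mul_sub, noncomm_pow_sub_pow_eq_sum, signSum_sub_flipAt,
      Finset.mul_sum, Matrix.trace_sum, Finset.mul_sum, Finset.mul_sum]
    refine Finset.sum_congr rfl fun q _ => ?_
    simp only [Matrix.mul_smul, Matrix.smul_mul, Matrix.trace_smul, smul_eq_mul,
      add_tsub_cancel_right, ← mul_assoc]
    rw [mul_comm _ (2 : ℝ), mul_assoc (2 : ℝ), boolSign_mul_self, mul_one]
  have h3 : ∑ s, (boolSign (s e) * (H e * signSum H s ^ (2 * p + 1)).trace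
      - boolSign (s e) * (H e * signSum H (flipAt e s) ^ (2 * p + 1)).trace)
      ≤ ∑ s, (2 * p + 1) * ((H e * H e * signSum H s ^ (2 * p)).trace
        + (H e * H e * signSum H (flipAt e s) ^ (2 * p)).trace) := by
    refine Finset.sum_le_sum fun s _ => ?_
    rw [h2]
    have := sum_trace_pow_mul_pow_le (hH e) (signSum_isSymm hH s)
      (signSum_isSymm hH (flipAt e s)) p
    linarith
  rw [Finset.sum_sub_distrib, ← Finset.mul_sum, Finset.sum_add_distrib,
    sum_flipAt e (fun s => (H e * H e * signSum H s ^ (2 * p)).trace)] at h3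
  linarith

theorem Matrix.IsSymm.pow_two_mul_apply_nonneg {X : Matrix N N ℝ} (hX : X.IsSymm) (p : ℕ) (i : N) :
    0 ≤ (X ^ (2 * p)) i i := by
  have : X ^ (2 * p) = X ^ p * (X ^ p).transpose := by
    rw [Matrix.transpose_pow, hX.eq, two_mul, pow_add]
  rw [this, Matrix.mul_apply]
  exact Finset.sum_nonneg fun j _ => mul_self_nonneg _

/-- One step of the noncommutative Khintchine inequality. -/
theorem sum_trace_signSum_pow_succ_le {H : E → Matrix N N ℝ} (hH : ∀ e, (H e).IsSymm)
    {v : N → ℝ} (hv : ∑ e, H e * H e = Matrix.diagonal v) {d : ℝ} (hd : ∀ i, v i ≤ d) (p : ℕ) :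
    ∑ s, (signSum H s ^ (2 * (p + 1))).trace
      ≤ (2 * p + 1) * d * ∑ s, (signSum H s ^ (2 * p)).trace := by
  have h1 : ∀ s, (signSum H s ^ (2 * (p + 1))).trace
      = ∑ e, boolSign (s e) * (H e * signSum H s ^ (2 * p + 1)).trace := by
    intro s
    rw [show 2 * (p + 1) = 2 * p + 1 + 1 by ring, pow_succ']
    nth_rw 1 [signSum]
    rw [Finset.sum_mul, Matrix.trace_sum]
    simp only [Matrix.smul_mul, Matrix.trace_smul, smul_eq_mul]
  calc ∑ s, (signSum H s ^ (2 * (p + 1))).trace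
      = ∑ e, ∑ s, boolSign (s e) * (H e * signSum H s ^ (2 * p + 1)).trace := by
        simp only [h1]; exact Finset.sum_comm
    _ ≤ ∑ e, (2 * p + 1) * ∑ s, (H e * H e * signSum H s ^ (2 * p)).trace :=
        Finset.sum_le_sum fun e _ => sum_sign_trace_le hH p e
    _ = (2 * p + 1) * ∑ s, (Matrix.diagonal v * signSum H s ^ (2 * p)).trace := by
        rw [← Finset.mul_sum, Finset.sum_comm]
        simp only [← hv, Finset.sum_mul, Matrix.trace_sum]
    -- Because the variance is diagonal, only diagonal entries of the even power enter, and these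
    -- are nonnegative.
    _ ≤ (2 * p + 1) * ∑ s, d * (signSum H s ^ (2 * p)).trace := by
        gcongr with s
        simp only [Matrix.trace, Matrix.diag, Matrix.diagonal_mul, Finset.mul_sum]
        exact Finset.sum_le_sum fun i _ => mul_le_mul_of_nonneg_right (hd i)
          ((signSum_isSymm hH s).pow_two_mul_apply_nonneg p i)
    _ = _ := by rw [← Finset.mul_sum]; ring

/-- The noncommutative Khintchine inequality for even moments. -/
theorem sum_trace_signSum_pow_le {H : E → Matrix N N ℝ} (hH : ∀ e, (H e).IsSymm)
    {v : N → ℝ} (hv : ∑ e, H e * H e = Matrix.diagonal v) {d : ℝ} (hd0 : 0 ≤ d)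
    (hd : ∀ i, v i ≤ d) {p m : ℕ} (hpm : p ≤ m) :
    ∑ s, (signSum H s ^ (2 * p)).trace
      ≤ (2 * m * d) ^ p * (Fintype.card (E → Bool) * Fintype.card N) := by
  induction p with
  | zero => simp [Matrix.trace_one]
  | succ p ih =>
    refine (sum_trace_signSum_pow_succ_le hH hv hd p).trans ?_
    have hp : (p : ℝ) + 1 ≤ m := by exact_mod_cast hpm
    rw [pow_succ', mul_assoc (2 * m * d)]
    refine mul_le_mul ?_ (ih (by omega)) ?_ (by positivity)
    · exact mul_le_mul_of_nonneg_right (by linarith) hd0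
    · exact Finset.sum_nonneg fun s _ => Finset.sum_nonneg fun i _ =>
        (signSum_isSymm hH s).pow_two_mul_apply_nonneg p i

/-- Even powers of a quadratic form are controlled by the trace of even powers. -/
theorem quadForm_pow_le_trace {X : Matrix N N ℝ} (hX : X.IsSymm) (u : N → ℝ)
    (hu : ∑ i, u i ^ 2 = 1) (p : ℕ) :
    (∑ i, ∑ j, X i j * (u i * u j)) ^ (2 * p) ≤ (X ^ (2 * p)).trace := by
  obtain ⟨U, x, hU1, hU2, hx⟩ := hX.exists_diagonalization
  set w := U.transpose.mulVec u with hw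
  have hw1 : ∑ k, w k ^ 2 = 1 := by
    have : w ⬝ᵥ w = u ⬝ᵥ u := by
      rw [hw, Matrix.dotProduct_mulVec, Matrix.vecMul_transpose, Matrix.mulVec_mulVec, hU1,
        Matrix.one_mulVec]
    simpa [dotProduct, ← sq, hu] using this
  have hq : ∑ i, ∑ j, X i j * (u i * u j) = ∑ k, w k ^ 2 * x k := by
    have h0 : ∑ i, ∑ j, X i j * (u i * u j) = u ⬝ᵥ X.mulVec u := by
      simp only [dotProduct, Matrix.mulVec, Finset.mul_sum]
      exact Finset.sum_congr rfl fun i _ => Finset.sum_congr rfl fun j _ => by ring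
    have h1 : u ⬝ᵥ X.mulVec u = w ⬝ᵥ (Matrix.diagonal x).mulVec w := by
      have := hx 1
      simp only [pow_one] at this
      rw [this, ← Matrix.mulVec_mulVec, ← Matrix.mulVec_mulVec, Matrix.dotProduct_mulVec u U,
        ← Matrix.mulVec_transpose]
    rw [h0, h1]
    simp only [dotProduct, Matrix.mulVec_diagonal]
    exact Finset.sum_congr rfl fun k _ => by ring
  have htr : (X ^ (2 * p)).trace = ∑ k, x k ^ (2 * p) := by
    rw [hx, Matrix.trace_mul_comm, ← mul_assoc, hU2, one_mul, Matrix.trace_diagonal]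
  rw [hq, htr]
  -- Jensen's inequality, with the squared coordinates of u in the eigenbasis as weights.
  refine (Real.pow_arith_mean_le_arith_mean_pow_of_even Finset.univ _ _
    (fun k _ => sq_nonneg (w k)) hw1 (even_two_mul p)).trans ?_
  refine Finset.sum_le_sum fun k _ => ?_
  have : w k ^ 2 ≤ 1 := by
    rw [← hw1]
    exact Finset.single_le_sum (f := fun k => w k ^ 2) (fun k _ => sq_nonneg _) (Finset.mem_univ k)
  exact mul_le_of_le_one_left ((even_two_mul p).pow_nonneg _) this

end Khintchine

/-! ### Product Bernoulli weights: exponential moments, tails and symmetrization. -/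

section Bernoulli
variable {E : Type*} [Fintype E] [DecidableEq E]

/-- The numerical value of a Boolean. -/
def boolVal (b : Bool) : ℝ := if b then 1 else 0

/-- The probability of `a` under independent Bernoulli coordinates with parameters `p`. -/
def bernWt (p : E → ℝ) (a : E → Bool) : ℝ := ∏ e, if a e then p e else 1 - p e

theorem bernWt_nonneg {p : E → ℝ} (hp : ∀ e, p e ∈ Set.Icc (0 : ℝ) 1) (a : E → Bool) :
    0 ≤ bernWt p a :=
  Finset.prod_nonneg fun e _ => by
    obtain ⟨h0, h1⟩ := hp e
    split_ifs <;> linarith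

theorem sum_bernWt_mul_prod (p : E → ℝ) (g : E → Bool → ℝ) :
    ∑ a, bernWt p a * ∏ e, g e (a e) = ∏ e, (p e * g e true + (1 - p e) * g e false) := by
  have h : ∀ e, p e * g e true + (1 - p e) * g e false
      = ∑ b : Bool, (if b then p e else 1 - p e) * g e b := by intro e; simp
  simp only [h, bernWt, ← Finset.prod_mul_distrib]
  rw [Finset.prod_univ_sum, Fintype.piFinset_univ]

theorem sum_bernWt (p : E → ℝ) : ∑ a, bernWt p a = 1 := by
  simpa using sum_bernWt_mul_prod p fun _ _ => 1

theorem sum_bernWt_mul_boolVal (p : E → ℝ) (e : E) :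
    ∑ a, bernWt p a * boolVal (a e) = p e := by
  have := sum_bernWt_mul_prod p fun f b => if f = e then boolVal b else 1
  simp only [Finset.prod_ite_eq', Finset.mem_univ, if_true] at this
  rw [this, Finset.prod_eq_single e]
  · simp [boolVal]
  · intro f _ hf; simp [hf]
  · simp

/-- The sum factorizes over coordinates; each factor is bounded through 1 + y ≤ e^y and e^x - 1 - x
≤ x² for |x| ≤ 1, with h² ≤ h making the exponent linear in h. -/
theorem sum_bernWt_exp_le {p h : E → ℝ} (hp : ∀ e, p e ∈ Set.Icc (0 : ℝ) 1)
    (hh : ∀ e, h e ∈ Set.Icc (0 : ℝ) 1) {θ v : ℝ} (hθ : |θ| ≤ 1) (hv : ∑ e, p e * h e ≤ v) :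
    ∑ a, bernWt p a * Real.exp (θ * ∑ e, h e * (boolVal (a e) - p e))
      ≤ Real.exp (θ ^ 2 * v) := by
  have h1 := sum_bernWt_mul_prod p fun e b => Real.exp (θ * (h e * (boolVal b - p e)))
  simp only [← Real.exp_sum, ← Finset.mul_sum] at h1
  rw [h1]
  calc ∏ e, (p e * Real.exp (θ * (h e * (boolVal true - p e)))
        + (1 - p e) * Real.exp (θ * (h e * (boolVal false - p e))))
      ≤ ∏ e, Real.exp (θ ^ 2 * (p e * h e)) := by
        refine Finset.prod_le_prod (fun e _ => ?_) fun e _ => ?_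
        · obtain ⟨h0, h1⟩ := hp e
          have := sub_nonneg.2 h1
          positivity
        · obtain ⟨hp0, hp1⟩ := hp e
          obtain ⟨hh0, hh1⟩ := hh e
          have e1 : Real.exp (θ * (h e * (boolVal true - p e)))
              = Real.exp (-(θ * h e * p e)) * Real.exp (θ * h e) := by
            rw [← Real.exp_add]; simp only [boolVal, if_true]; ring_nf
          have e2 : Real.exp (θ * (h e * (boolVal false - p e)))
              = Real.exp (-(θ * h e * p e)) := by
            simp only [boolVal]; congr 1; simp; ring
          have hx : |θ * h e| ≤ 1 := by
            rw [abs_mul, abs_of_nonneg hh0]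
            exact mul_le_one₀ hθ hh0 hh1
          have hb := (abs_le.1 (Real.abs_exp_sub_one_sub_id_le hx)).2
          have hs : (θ * h e) ^ 2 ≤ θ ^ 2 * h e := by
            rw [mul_pow]; exact mul_le_mul_of_nonneg_left (by nlinarith) (sq_nonneg _)
          have h3 : 1 + p e * (Real.exp (θ * h e) - 1)
              ≤ Real.exp (p e * (Real.exp (θ * h e) - 1)) := by
            linarith [Real.add_one_le_exp (p e * (Real.exp (θ * h e) - 1))]
          rw [e1, e2]
          calc _ = Real.exp (-(θ * h e * p e)) * (1 + p e * (Real.exp (θ * h e) - 1)) := by ring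
            _ ≤ Real.exp (-(θ * h e * p e)) * Real.exp (p e * (Real.exp (θ * h e) - 1)) := by
              gcongr
            _ = Real.exp (p e * (Real.exp (θ * h e) - 1 - θ * h e)) := by
              rw [← Real.exp_add]; congr 1; ring
            _ ≤ _ := by
              apply Real.exp_le_exp.2
              have : p e * (Real.exp (θ * h e) - 1 - θ * h e) ≤ p e * (θ ^ 2 * h e) :=
                mul_le_mul_of_nonneg_left (hb.trans hs) hp0
              linarith
    _ = Real.exp (θ ^ 2 * ∑ e, p e * h e) := by rw [← Real.exp_sum, Finset.mul_sum]
    _ ≤ _ := Real.exp_le_exp.2 (mul_le_mul_of_nonneg_left hv (sq_nonneg _))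

/-- Markov's inequality. -/
theorem sum_bernWt_filter_le {p : E → ℝ} (hp : ∀ e, p e ∈ Set.Icc (0 : ℝ) 1)
    (S : (E → Bool) → Prop) [DecidablePred S] {f : (E → Bool) → ℝ} {c K : ℝ} (hc : 0 < c)
    (hf : ∀ a, 0 ≤ f a) (hS : ∀ a, S a → c ≤ f a) (hK : ∑ a, bernWt p a * f a ≤ K) :
    ∑ a with S a, bernWt p a ≤ K / c := by
  rw [le_div_iff₀ hc, Finset.sum_mul]
  refine le_trans ?_ hK
  refine (Finset.sum_le_sum fun a ha => ?_).trans
    (Finset.sum_le_sum_of_subset_of_nonneg (Finset.filter_subset S _)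
      fun a _ _ => mul_nonneg (bernWt_nonneg hp a) (hf a))
  exact mul_le_mul_of_nonneg_left (hS a (Finset.mem_filter.1 ha).2) (bernWt_nonneg hp a)

open Classical in
/-- A Chernoff bound for weighted sums of independent Bernoulli variables. -/
theorem sum_bernWt_deviation_le {p h : E → ℝ} (hp : ∀ e, p e ∈ Set.Icc (0 : ℝ) 1)
    (hh : ∀ e, h e ∈ Set.Icc (0 : ℝ) 1) {θ v δ : ℝ} (hθ0 : 0 ≤ θ) (hθ : θ ≤ 1)
    (hv : ∑ e, p e * h e ≤ v) :
    ∑ a with δ < |∑ e, h e * (boolVal (a e) - p e)|, bernWt p a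
      ≤ 2 * Real.exp (θ ^ 2 * v - θ * δ) := by
  have hab : |θ| ≤ 1 := by rwa [abs_of_nonneg hθ0]
  have h1 := sum_bernWt_exp_le hp hh hab hv
  have h2 := sum_bernWt_exp_le hp hh (by rwa [abs_neg] : |(-θ)| ≤ 1) hv
  rw [neg_sq] at h2
  have h3 := sum_bernWt_filter_le hp (fun a => δ < |∑ e, h e * (boolVal (a e) - p e)|)
    (f := fun a => Real.exp (θ * ∑ e, h e * (boolVal (a e) - p e))
      + Real.exp (-θ * ∑ e, h e * (boolVal (a e) - p e)))
    (K := Real.exp (θ ^ 2 * v) + Real.exp (θ ^ 2 * v)) (Real.exp_pos (θ * δ))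
    (fun a => by positivity) ?_ ?_
  · rw [Real.exp_sub]
    refine h3.trans (le_of_eq ?_)
    ring
  · intro a ha
    rcases lt_abs.1 ha with ha | ha
    · refine le_add_of_le_of_nonneg (Real.exp_le_exp.2 ?_) (Real.exp_pos _).le
      exact mul_le_mul_of_nonneg_left ha.le hθ0
    · refine le_add_of_nonneg_of_le (Real.exp_pos _).le (Real.exp_le_exp.2 ?_)
      rw [neg_mul, ← mul_neg]
      exact mul_le_mul_of_nonneg_left ha.le hθ0
  · simp only [mul_add, Finset.sum_add_distrib]
    exact add_le_add h1 h2

/-- This is x/s ≤ exp(x/s - 1) raised to the power m; it trades a moment for an exponential moment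
at θ = m/s. -/
theorem pow_le_pow_mul_exp {x s : ℝ} (hx : 0 ≤ x) (hs : 0 < s) (m : ℕ) :
    x ^ m ≤ s ^ m * Real.exp (-m) * Real.exp (m / s * x) := by
  have h1 : x / s ≤ Real.exp (x / s - 1) := by linarith [Real.add_one_le_exp (x / s - 1)]
  have h2 : (x / s) ^ m ≤ Real.exp (m * (x / s - 1)) := by
    rw [Real.exp_nat_mul]; exact pow_le_pow_left₀ (by positivity) h1 m
  rw [div_pow, div_le_iff₀ (by positivity)] at h2
  refine h2.trans (le_of_eq ?_)
  rw [mul_assoc, ← Real.exp_add, mul_comm]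
  congr 2; ring

/-- Moments of the number of (weighted) disagreements between two independent copies. -/
theorem sum_bernWt_sq_diff_pow_le {p h : E → ℝ} (hp : ∀ e, p e ∈ Set.Icc (0 : ℝ) 1)
    (hh : ∀ e, h e ∈ Set.Icc (0 : ℝ) 1) {s : ℝ} (hs : 0 < s) (hv : ∑ e, p e * h e ≤ s / 4)
    {m : ℕ} (hm : (m : ℝ) ≤ s) :
    ∑ a, ∑ a', bernWt p a * bernWt p a' *
      (∑ e, (boolVal (a e) - boolVal (a' e)) ^ 2 * h e) ^ m ≤ s ^ m := by
  set θ : ℝ := m / s with hθ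
  have hθ0 : 0 ≤ θ := by positivity
  have hθ1 : θ ≤ 1 := (div_le_one hs).2 hm
  set g : (E → Bool) → ℝ := fun a => Real.exp (θ * ∑ e, h e * boolVal (a e)) with hg
  have hgs : ∑ a, bernWt p a * g a ≤ Real.exp (m / 2) := by
    have h1 := sum_bernWt_exp_le hp hh (by rwa [abs_of_nonneg hθ0] : |θ| ≤ 1) hv
    have h2 : ∀ a, bernWt p a * g a = bernWt p a *
        Real.exp (θ * ∑ e, h e * (boolVal (a e) - p e)) * Real.exp (θ * ∑ e, p e * h e) := by
      intro a
      rw [mul_assoc, ← Real.exp_add, ← mul_add, ← Finset.sum_add_distrib]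
      simp only [hg]
      congr 3
      exact Finset.sum_congr rfl fun e _ => by ring
    simp only [h2, ← Finset.sum_mul]
    calc _ ≤ Real.exp (θ ^ 2 * (s / 4)) * Real.exp (θ * ∑ e, p e * h e) := by gcongr
      _ ≤ Real.exp (θ ^ 2 * (s / 4)) * Real.exp (θ * (s / 4)) := by gcongr
      -- Since θ s = m and θ ≤ 1, both exponents are at most m/4. Two copies thus give e^m, which
      -- cancels the factor e^(-m) from `pow_le_pow_mul_exp`.
      _ ≤ Real.exp (m / 2) := by
        rw [← Real.exp_add]
        apply Real.exp_le_exp.2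
        have : θ * s = m := by rw [hθ]; field_simp
        nlinarith
  have hpt : ∀ a a' : E → Bool, (∑ e, (boolVal (a e) - boolVal (a' e)) ^ 2 * h e) ^ m
      ≤ s ^ m * Real.exp (-m) * (g a * g a') := by
    intro a a'
    refine (pow_le_pow_mul_exp (Finset.sum_nonneg fun e _ =>
      mul_nonneg (sq_nonneg _) (hh e).1) hs m).trans ?_
    rw [← hθ, hg]
    simp only [← Real.exp_add, ← mul_add, ← Finset.sum_add_distrib]
    refine mul_le_mul_of_nonneg_left (Real.exp_le_exp.2 (mul_le_mul_of_nonneg_left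
      (Finset.sum_le_sum fun e _ => ?_) hθ0)) (by positivity)
    have : (boolVal (a e) - boolVal (a' e)) ^ 2 ≤ boolVal (a e) + boolVal (a' e) := by
      cases a e <;> cases a' e <;> simp [boolVal]
    linarith [mul_le_mul_of_nonneg_right this (hh e).1]
  calc _ ≤ ∑ a, ∑ a', bernWt p a * bernWt p a' * (s ^ m * Real.exp (-m) * (g a * g a')) := by
        gcongr with a _ a' _
        · exact mul_nonneg (bernWt_nonneg hp a) (bernWt_nonneg hp a')
        · exact hpt a a'
    _ = s ^ m * Real.exp (-m) * ((∑ a, bernWt p a * g a) * ∑ a', bernWt p a' * g a') := by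
        rw [Finset.sum_mul_sum, Finset.mul_sum]
        refine Finset.sum_congr rfl fun a _ => ?_
        rw [Finset.mul_sum]
        exact Finset.sum_congr rfl fun a' _ => by ring
    _ ≤ s ^ m * Real.exp (-m) * (Real.exp (m / 2) * Real.exp (m / 2)) := by
        gcongr
        exact Finset.sum_nonneg fun a _ => mul_nonneg (bernWt_nonneg hp a) (Real.exp_pos _).le
    _ = s ^ m := by
        rw [mul_assoc, ← Real.exp_add, ← Real.exp_add]
        have : -(m : ℝ) + (m / 2 + m / 2) = 0 := by ring
        rw [this, Real.exp_zero, mul_one]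

/-- Exchanging the coordinates of a pair of vectors where `s` is false. -/
def exchange (s : E → Bool) (x : (E → Bool) × (E → Bool)) : (E → Bool) × (E → Bool) :=
  (fun e => if s e then x.1 e else x.2 e, fun e => if s e then x.2 e else x.1 e)

theorem exchange_involutive (s : E → Bool) : Function.Involutive (exchange s) := by
  rintro ⟨a, a'⟩
  ext e <;> by_cases h : s e <;> simp [exchange, h]

/-- The difference of two independent copies is symmetrically distributed. -/
theorem sum_bernWt_symmetrize (p : E → ℝ) (G : (E → ℝ) → ℝ) (s : E → Bool) :
    ∑ a, ∑ a', bernWt p a * bernWt p a' * G (fun e => boolVal (a e) - boolVal (a' e))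
      = ∑ a, ∑ a', bernWt p a * bernWt p a' *
        G (fun e => boolSign (s e) * (boolVal (a e) - boolVal (a' e))) := by
  simp only [← Fintype.sum_prod_type' (f := fun a a' => bernWt p a * bernWt p a' *
      G (fun e => boolVal (a e) - boolVal (a' e))),
    ← Fintype.sum_prod_type' (f := fun a a' => bernWt p a * bernWt p a' *
        G (fun e => boolSign (s e) * (boolVal (a e) - boolVal (a' e))))]
  rw [← Equiv.sum_comp (exchange_involutive s).toPerm]
  refine Finset.sum_congr rfl fun x _ => ?_
  congr 1
  · simp only [bernWt, ← Finset.prod_mul_distrib]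
    refine Finset.prod_congr rfl fun e _ => ?_
    by_cases h : s e <;> simp [exchange, h, mul_comm]
  · congr 1
    ext e
    by_cases h : s e <;> simp [exchange, boolSign, h]

end Bernoulli

/-! ### Edge matrices and the spectral bound. -/

section Edges
variable {n : ℕ}

/-- The pairs `i < j` of nodes. -/
abbrev Edge (n : ℕ) := {p : Fin n × Fin n // p.1 < p.2}

/-- The adjacency matrix of the graph with the single edge `e`. -/
def edgeMat (e : Edge n) : Matrix (Fin n) (Fin n) ℝ :=
  Matrix.single e.1.1 e.1.2 1 + Matrix.single e.1.2 e.1.1 1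

theorem edgeMat_isSymm (e : Edge n) : (edgeMat e).IsSymm := by
  simp [edgeMat, Matrix.IsSymm, add_comm]

theorem edgeMat_apply (e : Edge n) (i j : Fin n) :
    edgeMat e i j = (if e.1.1 = i ∧ e.1.2 = j then 1 else 0)
      + (if e.1.2 = i ∧ e.1.1 = j then 1 else 0) := by
  simp [edgeMat, Matrix.single_apply]

theorem sum_edgeMat (e : Edge n) (i : Fin n) (T : Finset (Fin n)) :
    ∑ j ∈ T, edgeMat e i j = (if e.1.1 = i ∧ e.1.2 ∈ T then 1 else 0)
      + (if e.1.2 = i ∧ e.1.1 ∈ T then 1 else 0) := by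
  simp only [edgeMat_apply, Finset.sum_add_distrib, ite_and]
  split_ifs <;> simp_all

theorem sum_edgeMat_mem_Icc (e : Edge n) (i : Fin n) (T : Finset (Fin n)) :
    ∑ j ∈ T, edgeMat e i j ∈ Set.Icc (0 : ℝ) 1 := by
  have := e.2.ne
  rw [sum_edgeMat]
  constructor
  · split_ifs <;> norm_num
  · split_ifs with h1 h2 <;> first | exact absurd (h1.1.trans h2.1.symm) this | norm_num

theorem edgeMat_mul_self (e : Edge n) :
    edgeMat e * edgeMat e = Matrix.diagonal fun i => ∑ j, edgeMat e i j := by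
  have := e.2.ne
  ext i j
  simp only [sum_edgeMat, Finset.mem_univ, and_true]
  rw [edgeMat, add_mul, mul_add, mul_add, Matrix.single_mul_single_of_ne _ _ _ _ this.symm,
    Matrix.single_mul_single_of_ne _ _ _ _ this, Matrix.single_mul_single_same,
    Matrix.single_mul_single_same, Matrix.diagonal_apply]
  simp only [Matrix.add_apply, Matrix.single_apply, mul_one, zero_add, add_zero]
  by_cases hij : i = j
  · subst hij; simp
  · rw [if_neg hij, if_neg, if_neg, add_zero]
    · rintro ⟨rfl, rfl⟩; exact hij rfl
    · rintro ⟨rfl, rfl⟩; exact hij rfl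

/-- The symmetric matrix with zero diagonal and entries `c` above the diagonal. -/
def edgeSum (c : Edge n → ℝ) : Matrix (Fin n) (Fin n) ℝ := ∑ e, c e • edgeMat e

theorem edgeSum_apply (c : Edge n → ℝ) (i j : Fin n) :
    edgeSum c i j = ∑ e, c e * edgeMat e i j := by
  simp [edgeSum, Matrix.sum_apply]

theorem edgeSum_isSymm (c : Edge n → ℝ) : (edgeSum c).IsSymm := by
  simp only [edgeSum, Matrix.IsSymm, Matrix.transpose_sum, Matrix.transpose_smul,
    (edgeMat_isSymm _).eq]

theorem edgeSum_apply_self (c : Edge n → ℝ) (i : Fin n) : edgeSum c i i = 0 := by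
  rw [edgeSum_apply]
  refine Finset.sum_eq_zero fun e _ => ?_
  have := e.2.ne
  rw [edgeMat_apply, if_neg, if_neg]
  · simp
  · rintro ⟨h1, h2⟩; exact this (h2.trans h1.symm)
  · rintro ⟨h1, h2⟩; exact this (h1.trans h2.symm)

theorem edgeSum_apply_lt (c : Edge n → ℝ) {i j : Fin n} (h : i < j) :
    edgeSum c i j = c ⟨(i, j), h⟩ := by
  rw [edgeSum_apply, Finset.sum_eq_single ⟨(i, j), h⟩]
  · simp [edgeMat_apply, h.ne, h.ne']
  · rintro ⟨⟨a, b⟩, hab⟩ - hne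
    rw [edgeMat_apply, if_neg, if_neg]
    · simp
    · rintro ⟨rfl, rfl⟩; exact lt_asymm h hab
    · rintro ⟨rfl, rfl⟩; exact hne rfl
  · simp

theorem eq_edgeSum {X : Matrix (Fin n) (Fin n) ℝ} (hX : X.IsSymm) (hd : ∀ i, X i i = 0) :
    X = edgeSum fun e => X e.1.1 e.1.2 := by
  ext i j
  rcases lt_trichotomy i j with h | rfl | h
  · rw [edgeSum_apply_lt _ h]
  · rw [edgeSum_apply_self, hd]
  · rw [← hX.apply, ← (edgeSum_isSymm _).apply, edgeSum_apply_lt _ h]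

theorem sum_edgeMat_le (i : Fin n) (T : Finset (Fin n)) :
    ∑ e : Edge n, ∑ j ∈ T, edgeMat e i j ≤ T.card := by
  rw [Finset.sum_comm]
  have h : ∀ j, ∑ e : Edge n, edgeMat e i j ≤ 1 := by
    intro j
    have h0 := edgeSum_apply (fun _ : Edge n => (1 : ℝ)) i j
    simp only [one_mul] at h0
    rw [← h0]
    rcases lt_trichotomy i j with h | rfl | h
    · rw [edgeSum_apply_lt _ h]
    · rw [edgeSum_apply_self]; norm_num
    · rw [← (edgeSum_isSymm _).apply, edgeSum_apply_lt _ h]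
  simpa using Finset.sum_le_sum fun j (_ : j ∈ T) => h j

/-- The quadratic form of a matrix. -/
def quadForm (X : Matrix (Fin n) (Fin n) ℝ) (u : Fin n → ℝ) : ℝ := ∑ i, ∑ j, X i j * (u i * u j)

theorem quadForm_edgeSum (c : Edge n → ℝ) (u : Fin n → ℝ) :
    quadForm (edgeSum c) u = ∑ e, c e * quadForm (edgeMat e) u := by
  simp only [quadForm, edgeSum_apply, Finset.sum_mul, Finset.mul_sum]
  calc _ = ∑ i, ∑ e, ∑ j, c e * edgeMat e i j * (u i * u j) :=
        Finset.sum_congr rfl fun i _ => Finset.sum_comm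
    _ = _ := by
      rw [Finset.sum_comm]
      simp only [mul_assoc]

/-- The mean p is the average of an independent copy a', so Jensen's inequality replaces centring by
a difference of two copies. The right side no longer involves u, so the bound is uniform over unit
vectors. -/
theorem quadForm_pow_le {p : Edge n → ℝ} (hp : ∀ e, p e ∈ Set.Icc (0 : ℝ) 1)
    (a : Edge n → Bool) {u : Fin n → ℝ} (hu : ∑ i, u i ^ 2 = 1) (m : ℕ) :
    quadForm (edgeSum fun e => boolVal (a e) - p e) u ^ (2 * m)
      ≤ ∑ a', bernWt p a' *
        (edgeSum (fun e => boolVal (a e) - boolVal (a' e)) ^ (2 * m)).trace := by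
  have h1 : quadForm (edgeSum fun e => boolVal (a e) - p e) u
      = ∑ a', bernWt p a' * quadForm (edgeSum fun e => boolVal (a e) - boolVal (a' e)) u := by
    simp only [quadForm_edgeSum, Finset.mul_sum]
    rw [Finset.sum_comm]
    refine Finset.sum_congr rfl fun e _ => ?_
    simp only [← mul_assoc, ← Finset.sum_mul, mul_sub, Finset.sum_sub_distrib, sum_bernWt,
      sum_bernWt_mul_boolVal, one_mul]
  rw [h1]
  refine (Real.pow_arith_mean_le_arith_mean_pow_of_even Finset.univ _ _
    (fun a _ => bernWt_nonneg hp a) (sum_bernWt p) (even_two_mul m)).trans ?_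
  exact Finset.sum_le_sum fun a' _ => mul_le_mul_of_nonneg_left
    (quadForm_pow_le_trace (edgeSum_isSymm _) u hu m) (bernWt_nonneg hp a')

/-- Khintchine yields the largest D i; its power is bounded by a sum over i so that an expectation
over the coefficients can be taken termwise afterwards. This costs a second factor n. -/
theorem sum_trace_edgeSum_sign_le (hn : 0 < n) (c : Edge n → ℝ) (m : ℕ) :
    ∑ s : Edge n → Bool, (edgeSum (fun e => boolSign (s e) * c e) ^ (2 * m)).trace
      ≤ Fintype.card (Edge n → Bool) *
        (n * (2 * m) ^ m * ∑ i, (∑ e, c e ^ 2 * ∑ j, edgeMat e i j) ^ m) := by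
  set D : Fin n → ℝ := fun i => ∑ e, c e ^ 2 * ∑ j, edgeMat e i j with hD
  have hD0 : ∀ i, 0 ≤ D i := fun i => Finset.sum_nonneg fun e _ =>
    mul_nonneg (sq_nonneg _) (sum_edgeMat_mem_Icc e i _).1
  obtain ⟨i₀, -, hi₀⟩ := Finset.exists_max_image Finset.univ D ⟨⟨0, hn⟩, Finset.mem_univ _⟩
  have h1 : ∀ s : Edge n → Bool, edgeSum (fun e => boolSign (s e) * c e)
      = signSum (fun e => c e • edgeMat e) s := fun s => by
    simp only [edgeSum, signSum, mul_smul]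
  have h2 : ∑ e, (c e • edgeMat e) * (c e • edgeMat e) = Matrix.diagonal D := by
    ext i j
    simp only [Matrix.smul_mul, Matrix.mul_smul, edgeMat_mul_self, Matrix.sum_apply,
      Matrix.smul_apply, Matrix.diagonal_apply, smul_eq_mul, hD]
    split_ifs
    · exact Finset.sum_congr rfl fun e _ => by ring
    · simp
  have h3 := sum_trace_signSum_pow_le (fun e => (edgeMat_isSymm e).smul (c e)) h2 (hD0 i₀)
    (fun i => hi₀ i (Finset.mem_univ i)) (le_refl m)
  simp only [h1]
  refine h3.trans ?_
  rw [Fintype.card_fin, mul_pow]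
  have h4 : D i₀ ^ m ≤ ∑ i, D i ^ m :=
    Finset.single_le_sum (f := fun i => D i ^ m) (fun i _ => pow_nonneg (hD0 i) m)
      (Finset.mem_univ i₀)
  calc _ = Fintype.card (Edge n → Bool) * (n * (2 * m) ^ m * D i₀ ^ m) := by ring
    _ ≤ _ := by gcongr

open Classical in
/-- A spectral bound for centred symmetric Bernoulli matrices. -/
theorem sum_bernWt_spectral_le (hn : 0 < n) {p : Edge n → ℝ}
    (hp : ∀ e, p e ∈ Set.Icc (0 : ℝ) 1) {s t : ℝ} (hs : 0 < s) (ht : 0 < t)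
    (hv : ∀ i, ∑ e, p e * ∑ j, edgeMat e i j ≤ s / 4) {m : ℕ} (hm : (m : ℝ) ≤ s) :
    ∑ a with ∃ u : Fin n → ℝ, ∑ i, u i ^ 2 = 1 ∧
        t < quadForm (edgeSum fun e => boolVal (a e) - p e) u, bernWt p a
      ≤ n ^ 2 * (2 * m * s) ^ m / t ^ (2 * m) := by
  set tr : (Edge n → ℝ) → ℝ := fun c => (edgeSum c ^ (2 * m)).trace with htr
  have htr0 : ∀ c, 0 ≤ tr c := fun c => Finset.sum_nonneg fun i _ =>
    (edgeSum_isSymm c).pow_two_mul_apply_nonneg m i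
  refine sum_bernWt_filter_le hp _
    (f := fun a => ∑ a', bernWt p a' * tr fun e => boolVal (a e) - boolVal (a' e))
    (by positivity) (fun a => Finset.sum_nonneg fun a' _ => mul_nonneg (bernWt_nonneg hp a')
      (htr0 _)) ?_ ?_
  · rintro a ⟨u, hu, htu⟩
    exact (pow_le_pow_left₀ ht.le htu.le _).trans (quadForm_pow_le hp a hu m)
  set Z : ℝ := ∑ a, ∑ a', bernWt p a * bernWt p a' *
    tr (fun e => boolVal (a e) - boolVal (a' e)) with hZ
  have hZ0 : ∑ a, bernWt p a * ∑ a', bernWt p a' * tr (fun e => boolVal (a e) - boolVal (a' e))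
      = Z := by simp only [hZ, Finset.mul_sum, mul_assoc]
  rw [hZ0]
  have hcard : (0 : ℝ) < Fintype.card (Edge n → Bool) := by exact_mod_cast Fintype.card_pos
  refine le_of_mul_le_mul_left ?_ hcard
  -- Every fixed sign pattern leaves Z unchanged, so Z may be averaged over all patterns; Khintchine
  -- then applies for fixed a and a'.
  calc (Fintype.card (Edge n → Bool) : ℝ) * Z = ∑ s : Edge n → Bool, Z := by simp
    _ = ∑ s : Edge n → Bool, ∑ a, ∑ a', bernWt p a * bernWt p a' *
          tr (fun e => boolSign (s e) * (boolVal (a e) - boolVal (a' e))) :=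
        Finset.sum_congr rfl fun s _ => sum_bernWt_symmetrize p tr s
    _ = ∑ a, ∑ a', bernWt p a * bernWt p a' * ∑ s : Edge n → Bool,
          tr (fun e => boolSign (s e) * (boolVal (a e) - boolVal (a' e))) := by
        rw [Finset.sum_comm]
        refine Finset.sum_congr rfl fun a _ => ?_
        rw [Finset.sum_comm]
        simp only [Finset.mul_sum]
    _ ≤ ∑ a, ∑ a', bernWt p a * bernWt p a' * (Fintype.card (Edge n → Bool) *
          (n * (2 * m) ^ m * ∑ i, (∑ e, (boolVal (a e) - boolVal (a' e)) ^ 2 *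
            ∑ j, edgeMat e i j) ^ m)) := by
        gcongr with a _ a' _
        · exact mul_nonneg (bernWt_nonneg hp a) (bernWt_nonneg hp a')
        · exact sum_trace_edgeSum_sign_le hn _ m
    _ = Fintype.card (Edge n → Bool) * (n * (2 * m) ^ m * ∑ i, ∑ a, ∑ a',
          bernWt p a * bernWt p a' * (∑ e, (boolVal (a e) - boolVal (a' e)) ^ 2 *
            ∑ j, edgeMat e i j) ^ m) := by
        rw [Finset.sum_comm (s := (Finset.univ : Finset (Fin n)))]
        simp_rw [Finset.sum_comm (s := (Finset.univ : Finset (Fin n)))]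
        simp only [Finset.mul_sum]
        refine Finset.sum_congr rfl fun a _ => Finset.sum_congr rfl fun a' _ =>
          Finset.sum_congr rfl fun i _ => by ring
    _ ≤ Fintype.card (Edge n → Bool) * (n * (2 * m) ^ m * ∑ i : Fin n, s ^ m) := by
        gcongr with i
        exact sum_bernWt_sq_diff_pow_le hp (fun e => sum_edgeMat_mem_Icc e i _) hs (hv i) hm
    _ = _ := by
        simp only [Finset.sum_const, Finset.card_univ, Fintype.card_fin, nsmul_eq_mul]
        rw [mul_pow _ s]; ring

end Edges

/-! ### From the stochastic blockmodel to the certificate, with explicit constants. -/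

section Model
variable {n r : ℕ} {z : Fin n → Fin r} {B : Matrix (Fin r) (Fin r) ℝ}

/-- The edge probabilities of the stochastic blockmodel. -/
def edgeProb (z : Fin n → Fin r) (B : Matrix (Fin r) (Fin r) ℝ) (e : Edge n) : ℝ :=
  B (z e.1.1) (z e.1.2)

open Classical in
/-- The Boolean encoding of an adjacency matrix. -/
def edgeBits (X : Matrix (Fin n) (Fin n) ℝ) (e : Edge n) : Bool := decide (X e.1.1 e.1.2 = 1)

section Transfer
variable {Ω : Type*} [MeasurableSpace Ω] {μ : Measure Ω} [IsProbabilityMeasure μ]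
  {A : Ω → Matrix (Fin n) (Fin n) ℝ}

theorem IsSBM.eq_edgeSum_edgeBits (h : IsSBM μ z B A) (ω : Ω) :
    A ω = edgeSum fun e => boolVal (edgeBits (A ω) e) := by
  have h1 : (fun e : Edge n => boolVal (edgeBits (A ω) e)) = fun e => A ω e.1.1 e.1.2 := by
    ext e
    rcases h.binary ω e.1.1 e.1.2 with h0 | h0 <;> simp [boolVal, edgeBits, h0]
  rw [h1]
  exact eq_edgeSum (h.symm ω) (h.diag ω)

theorem IsSBM.measure_edgeBits_eq_le (h : IsSBM μ z B A) (hB : IsBlockProbMatrix B)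
    (a : Edge n → Bool) :
    μ {ω | edgeBits (A ω) = a} ≤ ENNReal.ofReal (bernWt (edgeProb z B) a) := by
  set s : Edge n → Set ℝ := fun e => {if a e then 1 else 0} with hs
  have hsm : ∀ e, MeasurableSet (s e) := fun e => measurableSet_singleton _
  have hsub : {ω | edgeBits (A ω) = a} ⊆
      ⋂ e ∈ (Finset.univ : Finset (Edge n)), (fun ω => A ω e.1.1 e.1.2) ⁻¹' s e := by
    rintro ω rfl
    simp only [Set.mem_iInter, Set.mem_preimage, hs, Set.mem_singleton_iff]
    intro e _
    rcases h.binary ω e.1.1 e.1.2 with h0 | h0 <;> simp [edgeBits, h0]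
  refine (measure_mono hsub).trans ?_
  rw [h.indep.measure_inter_preimage_eq_mul Finset.univ (fun e _ => hsm e), bernWt,
    ENNReal.ofReal_prod_of_nonneg]
  · refine Finset.prod_le_prod' fun e _ => ?_
    have hp := h.prob e.1.1 e.1.2 e.2
    by_cases hae : a e
    · simp only [hs, hae, if_true]
      exact hp.le
    · simp only [hs, hae]
      have hc : (fun ω => A ω e.1.1 e.1.2) ⁻¹' {if (false = true) then (1 : ℝ) else 0}
          = {ω | A ω e.1.1 e.1.2 = 1}ᶜ := by
        ext ω
        rcases h.binary ω e.1.1 e.1.2 with h0 | h0 <;> simp [h0]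
      have hm : MeasurableSet {ω | A ω e.1.1 e.1.2 = 1} :=
        h.measurable e.1.1 e.1.2 (measurableSet_singleton 1)
      simp only [Bool.false_eq_true, if_false] at hc ⊢
      rw [hc, prob_compl_eq_one_sub hm, hp, edgeProb,
        ENNReal.ofReal_sub _ (hB.mem_Icc _ _).1, ENNReal.ofReal_one]
  · intro e _
    obtain ⟨h0, h1⟩ := hB.mem_Icc (z e.1.1) (z e.1.2)
    simp only [edgeProb]
    split_ifs <;> linarith

theorem IsSBM.measure_edgeBits_le (h : IsSBM μ z B A) (hB : IsBlockProbMatrix B)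
    (S : (Edge n → Bool) → Prop) [DecidablePred S] :
    μ {ω | S (edgeBits (A ω))}
      ≤ ENNReal.ofReal (∑ a with S a, bernWt (edgeProb z B) a) := by
  have hsub : {ω | S (edgeBits (A ω))} ⊆
      ⋃ a ∈ Finset.univ.filter S, {ω | edgeBits (A ω) = a} := by
    intro ω hω
    simp only [Set.mem_iUnion]
    exact ⟨edgeBits (A ω), Finset.mem_filter.2 ⟨Finset.mem_univ _, hω⟩, rfl⟩
  refine (measure_mono hsub).trans ((measure_biUnion_finset_le _ _).trans ?_)
  have hp : ∀ e, edgeProb z B e ∈ Set.Icc (0 : ℝ) 1 := fun e => hB.mem_Icc _ _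
  rw [ENNReal.ofReal_sum_of_nonneg fun a _ => bernWt_nonneg hp a]
  exact Finset.sum_le_sum fun a _ => h.measure_edgeBits_eq_le hB a

end Transfer

/-- The expected adjacency matrix. -/
theorem edgeSum_edgeProb (hB : B.IsSymm) (i j : Fin n) :
    edgeSum (edgeProb z B) i j = if i = j then 0 else B (z i) (z j) := by
  have h := eq_edgeSum (X := Matrix.of fun i j : Fin n => if i = j then 0 else B (z i) (z j))
    (by ext i j; simp [eq_comm, hB.apply]) (by simp)
  have h2 : (fun e : Edge n => (Matrix.of fun i j : Fin n =>
      if i = j then 0 else B (z i) (z j)) e.1.1 e.1.2) = edgeProb z B := by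
    ext e; simp [edgeProb, e.2.ne]
  rw [h2] at h
  rw [← h]; rfl

theorem edgeSum_sub (c c' : Edge n → ℝ) (i j : Fin n) :
    edgeSum (fun e => c e - c' e) i j = edgeSum c i j - edgeSum c' i j := by
  simp only [edgeSum_apply, sub_mul, Finset.sum_sub_distrib]

theorem sum_edgeSum (c : Edge n → ℝ) (i : Fin n) (T : Finset (Fin n)) :
    ∑ j ∈ T, edgeSum c i j = ∑ e, (∑ j ∈ T, edgeMat e i j) * c e := by
  simp only [edgeSum_apply, Finset.sum_mul]
  rw [Finset.sum_comm]
  exact Finset.sum_congr rfl fun e _ => Finset.sum_congr rfl fun j _ => mul_comm _ _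

theorem quadForm_le_of_unit {X : Matrix (Fin n) (Fin n) ℝ} {t : ℝ}
    (h : ∀ u : Fin n → ℝ, ∑ i, u i ^ 2 = 1 → quadForm X u ≤ t) (x : Fin n → ℝ) :
    quadForm X x ≤ t * ∑ i, x i ^ 2 := by
  have hnn : 0 ≤ ∑ i, x i ^ 2 := Finset.sum_nonneg fun i _ => sq_nonneg _
  rcases hnn.eq_or_lt with h0 | hpos
  · have hx : ∀ i, x i = 0 := fun i => by
      have := (Finset.sum_eq_zero_iff_of_nonneg fun i (_ : i ∈ Finset.univ) => sq_nonneg (x i)).1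
        h0.symm i (Finset.mem_univ i)
      exact pow_eq_zero_iff two_ne_zero |>.1 this
    simp [quadForm, hx]
  · set N := ∑ i, x i ^ 2 with hN
    have hs : √N ^ 2 = N := Real.sq_sqrt hnn
    have hs0 : √N ≠ 0 := (Real.sqrt_pos.2 hpos).ne'
    have h1 := h (fun i => x i / √N) (by
      simp only [div_pow, hs, ← Finset.sum_div]; rw [← hN, div_self hpos.ne'])
    have h2 : quadForm X (fun i => x i / √N) = quadForm X x / N := by
      simp only [quadForm, Finset.sum_div]
      refine Finset.sum_congr rfl fun i _ => Finset.sum_congr rfl fun j _ => ?_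
      have : X i j * (x i / √N * (x j / √N)) = X i j * (x i * x j) / √N ^ 2 := by field_simp
      rw [this, hs]
    rwa [h2, div_le_iff₀ hpos] at h1

/-- The deterministic event on which the clustering is recovered. -/
theorem sdp1Recovers_of_concentration (hB : B.IsSymm) {w lam L : ℝ} (hw : 0 < w) (hL : 0 < L)
    {m : ℕ} (hm : 0 < m) (hmk : ∀ k, m ≤ clusterSize z k)
    (hdiag : ∀ k, 40 * √(n * w * L) ≤ m * (B k k - lam))
    (hoff : ∀ k l, k ≠ l → B k l + 13 * √(w * L / m) ≤ lam)
    (a : Edge n → Bool)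
    (h1 : ∀ u : Fin n → ℝ, ∑ i, u i ^ 2 = 1 →
      quadForm (edgeSum fun e => boolVal (a e) - edgeProb z B e) u ≤ 32 * √(n * w * L))
    (h2 : ∀ i k, |∑ e, (∑ j with z j = k, edgeMat e i j) * (boolVal (a e) - edgeProb z B e)|
      ≤ 4 * √(clusterSize z k * w * L)) :
    SDP1Recovers (edgeSum fun e => boolVal (a e)) lam z := by
  have hm0 : (0 : ℝ) < m := by exact_mod_cast hm
  have hdev : ∀ i k, |∑ j with z j = k, (edgeSum (fun e => boolVal (a e)) i j
      - if i = j then 0 else B (z i) (z j))| ≤ 4 * √(clusterSize z k * w * L) := by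
    intro i k
    have := h2 i k
    rw [← sum_edgeSum] at this
    simpa only [edgeSum_sub, edgeSum_edgeProb hB] using this
  have hmean : ∀ i k, ∑ j with z j = k, (if i = j then 0 else B (z i) (z j))
      = clusterSize z k * B (z i) k - if z i = k then B (z i) (z i) else 0 := by
    intro i k
    have e1 : ∑ j with z j = k, B (z i) (z j) = clusterSize z k * B (z i) k := by
      rw [← sum_const_cluster]
      exact Finset.sum_congr rfl fun j hj => by rw [(Finset.mem_filter.1 hj).2]
    have e2 : ∑ j with z j = k, (if i = j then B (z i) (z j) else 0)
        = if z i = k then B (z i) (z i) else 0 := by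
      rw [Finset.sum_ite_eq]; simp
    rw [← e1, ← e2, ← Finset.sum_sub_distrib]
    exact Finset.sum_congr rfl fun j _ => by split_ifs <;> ring
  -- Constants: 40 > 32 + 4 covers the spectral and the degree deviation, and 13 > 3 · 4 covers 3δ.
  refine sdp1Recovers_of_certificate z _ (edgeSum_isSymm _) B hB lam (32 * √(n * w * L))
    (4 * √(w * L / m)) ?_ ?_ ?_ ?_
  · intro x
    have := quadForm_le_of_unit h1 x
    simpa only [quadForm, edgeSum_sub, edgeSum_edgeProb hB] using this
  · intro i
    have h3 := (abs_le.1 (hdev i (z i))).1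
    rw [Finset.sum_sub_distrib, hmean, if_pos rfl] at h3
    have h4 : √(clusterSize z (z i) * w * L) ≤ √(n * w * L) := by
      refine Real.sqrt_le_sqrt ?_
      have : (clusterSize z (z i) : ℝ) ≤ n := by
        have := Finset.card_le_univ (Finset.univ.filter fun j => z j = z i)
        rw [Fintype.card_fin] at this
        exact_mod_cast this
      gcongr
    have hn : (0 : ℝ) < n := by exact_mod_cast i.pos
    have h5 : 0 < √(n * w * L) := Real.sqrt_pos.2 (by positivity)
    have h6 := hdiag (z i)
    have h7 : (m : ℝ) ≤ clusterSize z (z i) := by exact_mod_cast hmk _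
    have h8 : 0 ≤ B (z i) (z i) - lam := by
      by_contra hneg
      have := mul_neg_of_pos_of_neg hm0 (not_le.1 hneg)
      linarith
    have h9 := mul_le_mul_of_nonneg_right h7 h8
    linarith
  · intro i j hij
    have hc : (0 : ℝ) < clusterSize z (z j) := by exact_mod_cast hm.trans_le (hmk _)
    have h3 := hdev i (z j)
    rw [Finset.sum_sub_distrib, hmean, if_neg hij, sub_zero] at h3
    have h4 : (∑ j' with z j' = z j, edgeSum (fun e => boolVal (a e)) i j') /
        clusterSize z (z j) - B (z i) (z j)
        = ((∑ j' with z j' = z j, edgeSum (fun e => boolVal (a e)) i j')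
          - clusterSize z (z j) * B (z i) (z j)) / clusterSize z (z j) := by
      field_simp
    rw [h4, abs_div, abs_of_pos hc, div_le_iff₀ hc]
    refine h3.trans ?_
    have h5 : √(clusterSize z (z j) * w * L) = √(w * L / clusterSize z (z j)) *
        clusterSize z (z j) := by
      rw [← Real.sqrt_sq hc.le, ← Real.sqrt_mul (by positivity), Real.sqrt_sq hc.le]
      congr 1; field_simp
    rw [h5, ← mul_assoc]
    have h7 : (m : ℝ) ≤ clusterSize z (z j) := by exact_mod_cast hmk _
    gcongr
  · intro k l hkl
    have := hoff k l hkl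
    have : 0 < √(w * L / m) := Real.sqrt_pos.2 (by positivity)
    linarith

theorem sum_filter_le_add_sum {α ι : Type*} [Fintype α] [Fintype ι] {f : α → ℝ}
    (hf : ∀ a, 0 ≤ f a) (S S' : α → Prop) (T : ι → α → Prop) [DecidablePred S] [DecidablePred S']
    [∀ i, DecidablePred (T i)] (h : ∀ a, S a → S' a ∨ ∃ i, T i a) :
    ∑ a with S a, f a ≤ ∑ a with S' a, f a + ∑ i, ∑ a with T i a, f a := by
  simp only [Finset.sum_filter]
  rw [Finset.sum_comm, ← Finset.sum_add_distrib]
  refine Finset.sum_le_sum fun a _ => ?_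
  have h0 : ∀ i, 0 ≤ if T i a then f a else 0 := fun i => by split_ifs <;> simp [hf]
  have h1 : 0 ≤ ∑ i, if T i a then f a else 0 := Finset.sum_nonneg fun i _ => h0 i
  have h2 : 0 ≤ if S' a then f a else 0 := by split_ifs <;> simp [hf]
  split_ifs with hS hS' hS'
  · linarith
  · obtain ⟨i, hi⟩ := (h a hS).resolve_left hS'
    have := Finset.single_le_sum (fun i _ => h0 i) (Finset.mem_univ i)
    rw [if_pos hi] at this
    linarith
  · linarith [hf a]
  · linarith

-- A union bound: the spectral event fails with probability at most n⁻², and each of at most n²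
-- node-cluster pairs deviates with probability at most 2 n⁻⁴.
open Classical in
theorem sum_bernWt_not_recovers_le (hz : Function.Surjective z) (hB : IsBlockProbMatrix B)
    (hn : 3 ≤ n) {w lam : ℝ} (hw : 0 < w) (hBw : ∀ k l, B k l ≤ w)
    {m : ℕ} (hm : 0 < m) (hmk : ∀ k, m ≤ clusterSize z k)
    (hmw : 1600 * Real.log n ≤ m * w)
    (hdiag : ∀ k, 40 * √(n * w * Real.log n) ≤ m * (B k k - lam))
    (hoff : ∀ k l, k ≠ l → B k l + 13 * √(w * Real.log n / m) ≤ lam) :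
    ∑ a with ¬ SDP1Recovers (edgeSum fun e => boolVal (a e)) lam z, bernWt (edgeProb z B) a
      ≤ 3 / (n : ℝ) ^ 2 := by
  set L := Real.log n with hL
  have hn0 : (0 : ℝ) < n := by positivity
  have hL1 : 1 ≤ L := by
    rw [hL, Real.le_log_iff_exp_le hn0]
    have : (3 : ℝ) ≤ n := by exact_mod_cast hn
    linarith [Real.exp_one_lt_d9]
  have hexpL : Real.exp L = n := Real.exp_log hn0
  have hmn : (m : ℝ) ≤ n := by
    have h1 := hmk (z ⟨0, by omega⟩)
    have h2 := Finset.card_le_univ (Finset.univ.filter fun j => z j = z ⟨0, by omega⟩)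
    rw [Fintype.card_fin] at h2
    exact_mod_cast h1.trans h2
  have hp : ∀ e, edgeProb z B e ∈ Set.Icc (0 : ℝ) 1 := fun e => hB.mem_Icc _ _
  have hpT : ∀ (i : Fin n) (T : Finset (Fin n)),
      ∑ e, edgeProb z B e * ∑ j ∈ T, edgeMat e i j ≤ T.card * w := by
    intro i T
    calc _ ≤ ∑ e, w * ∑ j ∈ T, edgeMat e i j := Finset.sum_le_sum fun e _ =>
          mul_le_mul_of_nonneg_right (hBw _ _) (sum_edgeMat_mem_Icc e i T).1
      _ ≤ w * T.card := by
          rw [← Finset.mul_sum]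
          exact mul_le_mul_of_nonneg_left (sum_edgeMat_le i T) hw.le
      _ = _ := mul_comm _ _
  have hgood := fun a => sdp1Recovers_of_concentration hB.symm hw (by linarith) hm hmk hdiag hoff a
  refine (sum_filter_le_add_sum (bernWt_nonneg hp) _
    (fun a => ∃ u : Fin n → ℝ, ∑ i, u i ^ 2 = 1 ∧ 32 * √(n * w * L)
      < quadForm (edgeSum fun e => boolVal (a e) - edgeProb z B e) u)
    (fun (x : Fin n × Fin r) a => 4 * √(clusterSize z x.2 * w * L) <
      |∑ e, (∑ j with z j = x.2, edgeMat e x.1 j) * (boolVal (a e) - edgeProb z B e)|) ?_).trans ?_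
  · intro a ha
    by_contra! hcon
    exact ha (hgood a (fun u hu => hcon.1 u hu) fun i k => hcon.2 (i, k))
  have hspec : ∑ a with ∃ u : Fin n → ℝ, ∑ i, u i ^ 2 = 1 ∧ 32 * √(n * w * L)
      < quadForm (edgeSum fun e => boolVal (a e) - edgeProb z B e) u, bernWt (edgeProb z B) a
      ≤ 1 / (n : ℝ) ^ 2 := by
    -- With q ≤ 2L the ratio inside the q-th power is at most 16/1024 = 1/64 ≤ e⁻⁴, and q ≥ L turns
    -- n² e^(-4q) into at most n⁻².
    set q := ⌈L⌉₊ with hq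
    have hq1 : L ≤ q := Nat.le_ceil L
    have hq2 : (q : ℝ) ≤ 2 * L := by linarith [Nat.ceil_lt_add_one (by linarith : 0 ≤ L)]
    have hnw : 1600 * L ≤ n * w := hmw.trans (mul_le_mul_of_nonneg_right hmn hw.le)
    refine (sum_bernWt_spectral_le (s := 4 * (n * w)) (m := q) (by omega) hp (by positivity)
      (by have : 0 < L := by linarith
          positivity) (fun i => ?_) (by linarith)).trans ?_
    · have := hpT i Finset.univ
      rw [Finset.card_univ, Fintype.card_fin] at this
      linarith
    · have hg : (32 * √(n * w * L)) ^ (2 * q) = (1024 * (n * w * L)) ^ q := by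
        rw [pow_mul, mul_pow, Real.sq_sqrt (by positivity)]; norm_num
      have hle : (2 * q * (4 * (n * w))) ^ q ≤ (Real.exp (-4) * (1024 * (n * w * L))) ^ q := by
        refine pow_le_pow_left₀ (by positivity) ?_ q
        have he : 1 / 64 ≤ Real.exp (-4) := by
          rw [Real.exp_neg, ← one_div]
          apply one_div_le_one_div_of_le (Real.exp_pos _)
          have h1 : Real.exp 4 = Real.exp 1 ^ 4 := by rw [← Real.exp_nat_mul]; norm_num
          rw [h1]
          calc Real.exp 1 ^ 4 ≤ 2.8 ^ 4 :=
                pow_le_pow_left₀ (Real.exp_pos _).le (by linarith [Real.exp_one_lt_d9]) 4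
            _ ≤ 64 := by norm_num
        calc 2 * q * (4 * (n * w)) ≤ 2 * (2 * L) * (4 * (n * w)) := by gcongr
          _ = 1 / 64 * (1024 * (n * w * L)) := by ring
          _ ≤ _ := by gcongr
      rw [hg, div_le_iff₀ (by positivity)]
      calc _ ≤ (n : ℝ) ^ 2 * (Real.exp (-4) * (1024 * (n * w * L))) ^ q := by gcongr
        _ = (n : ℝ) ^ 2 * Real.exp (-4) ^ q * (1024 * (n * w * L)) ^ q := by
            rw [mul_pow (Real.exp (-4))]; ring
        _ ≤ _ := by
          refine mul_le_mul_of_nonneg_right ?_ (by positivity)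
          rw [le_div_iff₀ (by positivity), ← hexpL, ← Real.exp_nat_mul, ← Real.exp_nat_mul,
            ← Real.exp_add, ← Real.exp_add, Real.exp_le_one_iff]
          push_cast
          linarith
  have hdevs : ∀ x : Fin n × Fin r, ∑ a with 4 * √(clusterSize z x.2 * w * L) <
      |∑ e, (∑ j with z j = x.2, edgeMat e x.1 j) * (boolVal (a e) - edgeProb z B e)|,
        bernWt (edgeProb z B) a ≤ 2 / (n : ℝ) ^ 4 := by
    rintro ⟨i, k⟩
    set v : ℝ := clusterSize z k * w with hv
    have hc : (m : ℝ) ≤ clusterSize z k := by exact_mod_cast hmk k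
    have hv1 : 1600 * L ≤ v := hmw.trans (mul_le_mul_of_nonneg_right hc hw.le)
    have hv0 : 0 < v := by linarith
    -- This θ minimizes θ² v - 4θ√(vL), giving the exponent 4L - 8L = -4L; θ ≤ 1 holds because v ≥
    -- 1600 L.
    refine (sum_bernWt_deviation_le (θ := 2 * √(L / v)) (v := v) hp
      (fun e => sum_edgeMat_mem_Icc e i _) (by positivity) ?_ (hpT i _)).trans ?_
    · have : √(L / v) ≤ 1 / 2 := by
        rw [Real.sqrt_le_left (by norm_num), div_le_iff₀ hv0]
        linarith
      linarith
    · have h1 : (2 * √(L / v)) ^ 2 * v = 4 * L := by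
        rw [mul_pow, Real.sq_sqrt (by positivity)]; field_simp; norm_num
      have h2 : 2 * √(L / v) * (4 * √(v * L)) = 8 * L := by
        have : √(L / v) * √(v * L) = L := by
          rw [← Real.sqrt_mul (by positivity), show L / v * (v * L) = L ^ 2 by field_simp,
            Real.sqrt_sq (by linarith)]
        linear_combination 8 * this
      rw [h1, h2, ← hexpL, ← Real.exp_nat_mul, div_eq_mul_inv, ← Real.exp_neg]
      refine le_of_eq ?_
      congr 2; push_cast; ring
  have hr : (r : ℝ) ≤ n := by
    have := Fintype.card_le_of_surjective z hz
    simp only [Fintype.card_fin] at this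
    exact_mod_cast this
  have hsum : ∑ x : Fin n × Fin r, 2 / (n : ℝ) ^ 4 ≤ 2 / (n : ℝ) ^ 2 := by
    rw [Finset.sum_const, Finset.card_univ, Fintype.card_prod, Fintype.card_fin, Fintype.card_fin,
      nsmul_eq_mul]
    push_cast
    calc (n : ℝ) * r * (2 / n ^ 4) ≤ n * n * (2 / n ^ 4) := by gcongr
      _ = _ := by field_simp
  have := Finset.sum_le_sum fun x (_ : x ∈ Finset.univ) => hdevs x
  calc _ ≤ 1 / (n : ℝ) ^ 2 + 2 / (n : ℝ) ^ 2 := add_le_add hspec (this.trans hsum)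
    _ = _ := by ring

end Model

/-! ### Translation into cluster proportions and the limit. -/

section Main
variable {n r : ℕ} {z : Fin n → Fin r}

theorem exists_piMin_eq (hz : Function.Surjective z) (hn : 0 < n) :
    ∃ m : ℕ, 0 < m ∧ (∀ k, m ≤ clusterSize z k) ∧ piMin z = m / n := by
  have hn0 : (0 : ℝ) < n := by exact_mod_cast hn
  have : Nonempty (Fin r) := ⟨z ⟨0, hn⟩⟩
  obtain ⟨k₀, hk₀⟩ := exists_eq_ciInf_of_finite (f := fun k => (clusterSize z k : ℝ) / n)
  refine ⟨clusterSize z k₀, clusterSize_pos z hz k₀, fun k => ?_, hk₀.symm⟩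
  have h := ciInf_le (Set.finite_range fun k => (clusterSize z k : ℝ) / n).bddBelow k
  rw [← hk₀, div_le_div_iff_of_pos_right hn0] at h
  exact_mod_cast h

theorem piMax_pos (hz : Function.Surjective z) (hn : 0 < n) : 0 < piMax z := by
  have hn0 : (0 : ℝ) < n := by exact_mod_cast hn
  have hk := clusterSize_pos z hz (z ⟨0, hn⟩)
  have h := le_ciSup (Set.finite_range fun k => (clusterSize z k : ℝ) / n).bddAbove (z ⟨0, hn⟩)
  refine lt_of_lt_of_le ?_ h
  positivity

/-- Exact recovery at a fixed size, with an explicit failure probability. -/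
theorem IsSBM.measure_recovers_ge {B : Matrix (Fin r) (Fin r) ℝ} {Ω : Type*} [MeasurableSpace Ω]
    {μ : Measure Ω} [IsProbabilityMeasure μ] {A : Ω → Matrix (Fin n) (Fin n) ℝ}
    (hSBM : IsSBM μ z B A) (hz : Function.Surjective z) (hB : IsBlockProbMatrix B) (hn : 3 ≤ n)
    {M ρ lam : ℝ} (hM : 0 < M) (hρ : 0 < ρ) (hBM : ∀ k l, B k l ≤ M * ρ)
    (hoff : ∀ k l, k ≠ l → B k l + 13 * √M * √(ρ * Real.log n / (n * piMin z)) ≤ lam)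
    (hdiag : ∀ k, lam ≤ B k k - 40 * √M * (piMax z / piMin z) *
      √(ρ * Real.log n / (n * piMax z ^ 2))) :
    1 - ENNReal.ofReal (3 / (n : ℝ) ^ 2) ≤ μ {ω | SDP1Recovers (A ω) lam z} := by
  classical
  have hn0 : (0 : ℝ) < n := by positivity
  -- A negative lam is below every entry of B, which the lower bound on lam permits only with a
  -- single cluster. The remaining case needs lam ≥ 0 to derive `hmw`.
  rcases lt_or_ge lam 0 with hneg | hlam
  · have hzz : ∀ i j, z i = z j := by
      intro i j
      by_contra hij
      have h1 := hoff _ _ hij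
      have h2 := (hB.mem_Icc (z i) (z j)).1
      have h3 : 0 ≤ 13 * √M * √(ρ * Real.log n / (n * piMin z)) := by positivity
      linarith
    have : {ω | SDP1Recovers (A ω) lam z} = Set.univ := by
      refine Set.eq_univ_of_forall fun ω => ?_
      refine sdp1Recovers_of_neg z (A ω) (hSBM.symm ω) (fun i j => ?_) lam hneg hzz
      rcases hSBM.binary ω i j with h | h <;> rw [h]
      exact zero_le_one
    rw [this, measure_univ]
    exact tsub_le_self
  obtain ⟨m, hm, hmk, hpi⟩ := exists_piMin_eq hz (by omega)
  have hm0 : (0 : ℝ) < m := by exact_mod_cast hm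
  have hpm := piMax_pos hz (by omega)
  set L := Real.log n with hL
  have hL0 : 0 < L := Real.log_pos (by exact_mod_cast (by omega : 1 < n))
  set w := M * ρ with hw
  have hw0 : 0 < w := mul_pos hM hρ
  have hoff' : ∀ k l, k ≠ l → B k l + 13 * √(w * L / m) ≤ lam := by
    intro k l hkl
    have h1 := hoff k l hkl
    have h2 : √M * √(ρ * L / (n * piMin z)) = √(w * L / m) := by
      rw [← Real.sqrt_mul hM.le, hpi, hw]
      congr 1; field_simp
    rwa [mul_assoc, h2] at h1
  have hdiag' : ∀ k, 40 * √(n * w * L) ≤ m * (B k k - lam) := by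
    intro k
    have h1 := hdiag k
    -- Here `piMax` cancels and n times `piMin` is m.
    have h2 : m * (√M * (piMax z / piMin z) * √(ρ * L / (n * piMax z ^ 2))) = √(n * w * L) := by
      have h3 : √(n * w * L) = √M * (√(ρ * L / (n * piMax z ^ 2)) * (n * piMax z)) := by
        rw [← Real.sqrt_sq (by positivity : 0 ≤ n * piMax z), ← Real.sqrt_mul (by positivity),
          ← Real.sqrt_mul hM.le, hw]
        congr 1; field_simp
      rw [h3, hpi]; field_simp
    rw [← h2]
    have h4 := mul_le_mul_of_nonneg_left h1 hm0.le
    linarith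
  have hmn : (m : ℝ) ≤ n := by
    have h1 := hmk (z ⟨0, by omega⟩)
    have h2 := Finset.card_le_univ (Finset.univ.filter fun j => z j = z ⟨0, by omega⟩)
    rw [Fintype.card_fin] at h2
    exact_mod_cast h1.trans h2
  -- The density condition is implied by the upper bound on lam: as B k k - lam ≤ w, it gives
  -- 40√(nwL) ≤ mw, and squaring together with m ≤ n yields the claim.
  have hmw : 1600 * L ≤ m * w := by
    have h1 : 40 * √(n * w * L) ≤ m * w := by
      refine (hdiag' (z ⟨0, by omega⟩)).trans (mul_le_mul_of_nonneg_left ?_ hm0.le)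
      linarith [hBM (z ⟨0, by omega⟩) (z ⟨0, by omega⟩)]
    have h2 : 1600 * (n * w * L) ≤ (m * w) * (m * w) := by
      have := mul_self_le_mul_self (by positivity) h1
      have h3 := Real.mul_self_sqrt (by positivity : 0 ≤ n * w * L)
      nlinarith
    have h3 : (m * w) * (m * w) ≤ (n * w) * (m * w) := by gcongr
    have h4 : (n * w) * (1600 * L) ≤ (n * w) * (m * w) := by linarith
    exact le_of_mul_le_mul_left h4 (by positivity)
  have hbad := hSBM.measure_edgeBits_le hB
    (fun a => ¬ SDP1Recovers (edgeSum fun e => boolVal (a e)) lam z)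
  have hfin := sum_bernWt_not_recovers_le hz hB hn hw0 hBM hm hmk hmw hdiag' hoff'
  have hc : μ {ω | SDP1Recovers (A ω) lam z}ᶜ ≤ ENNReal.ofReal (3 / (n : ℝ) ^ 2) := by
    refine le_trans (measure_mono fun ω hω => ?_)
      (hbad.trans (ENNReal.ofReal_le_ofReal (le_trans (le_of_eq ?_) hfin)))
    · change ¬ _
      rw [← hSBM.eq_edgeSum_edgeBits ω]
      exact hω
    · congr
  rw [tsub_le_iff_right]
  calc (1 : ENNReal) = μ Set.univ := measure_univ.symm
    _ ≤ μ {ω | SDP1Recovers (A ω) lam z} + μ {ω | SDP1Recovers (A ω) lam z}ᶜ := by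
      rw [← Set.union_compl_self {ω | SDP1Recovers (A ω) lam z}]
      exact measure_union_le _ _
    _ ≤ _ := by gcongr

end Main

end

theorem mainTheorem7 (b M : ℝ) (hb : 0 < b) (hM : 0 < M) :
    ∃ C₁ C₂ : ℝ, 0 < C₁ ∧ 0 < C₂ ∧
      ∀ (Ω : ℕ → Type*) [∀ n, MeasurableSpace (Ω n)] (μ : ∀ n, Measure (Ω n))
        [∀ n, IsProbabilityMeasure (μ n)]
        (r : ℕ → ℕ) (z : ∀ n, Fin n → Fin (r n))
        (B : ∀ n, Matrix (Fin (r n)) (Fin (r n)) ℝ)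
        (A : ∀ n, Ω n → Matrix (Fin n) (Fin n) ℝ) (ρ lam : ℕ → ℝ),
        (∀ n, Function.Surjective (z n)) →
        (∀ n, IsBlockProbMatrix (B n)) →
        (∀ n, IsSBM (μ n) (z n) (B n) (A n)) →
        (∀ᶠ n in atTop, StronglyAssortative (B n)) →
        (∀ n, 0 < ρ n) →
        Tendsto ρ atTop (𝓝 0) →
        (∀ᶠ n in atTop, ∀ k l, b * ρ n ≤ B n k l ∧ B n k l ≤ M * ρ n) →
        (∀ᶠ n in atTop, ∀ k l, k ≠ l →
          B n k l + C₁ * √(ρ n * Real.log n / (n * piMin (z n))) ≤ lam n) →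
        (∀ᶠ n in atTop, ∀ k,
          lam n ≤ B n k k - C₂ * (piMax (z n) / piMin (z n)) *
            √(ρ n * Real.log n / (n * piMax (z n) ^ 2))) →
        Tendsto (fun n => μ n {ω | SDP1Recovers (A n ω) (lam n) (z n)}) atTop (𝓝 1) := by
  refine ⟨13 * √M, 40 * √M, by positivity, by positivity, ?_⟩
  intro Ω _ μ _ r z B A ρ lam hz hB hSBM _ hρ _ hBM hoff hdiag
  have hlim : Tendsto (fun n : ℕ => 1 - ENNReal.ofReal (3 / (n : ℝ) ^ 2)) atTop (𝓝 1) := by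
    have h1 : Tendsto (fun n : ℕ => (3 : ℝ) / (n : ℝ) ^ 2) atTop (𝓝 0) :=
      tendsto_const_nhds.div_atTop
        ((tendsto_pow_atTop two_ne_zero).comp tendsto_natCast_atTop_atTop)
    have h2 := ENNReal.Tendsto.sub (tendsto_const_nhds (x := (1 : ENNReal)))
      (ENNReal.tendsto_ofReal h1) (Or.inl ENNReal.one_ne_top)
    simpa using h2
  refine tendsto_of_tendsto_of_tendsto_of_le_of_le' hlim tendsto_const_nhds ?_
    (Eventually.of_forall fun n => prob_le_one)
  filter_upwards [hBM, hoff, hdiag, eventually_ge_atTop 3] with n h1 h2 h3 hn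
  exact (hSBM n).measure_recovers_ge (hz n) (hB n) hn hM (hρ n) (fun k l => (h1 k l).2) h2 h3
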